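/- Let $a, q \in C^\infty(\mathbb{R})$ be real-valued with $a \ge 0$, $q \ge 0$ and, with $\langle x\rangle := (1+x^2)^{1/2}$, assume: (i) $\lim_{|x|\to\infty} a(x) = +\infty$; (ii) for every $n \ge 1$ there is $C_n > 0$ with $|a^{(n)}(x)| \le C_n (1+a(x)) \langle x\rangle^{-n}$ for all $x \in \mathbb{R}$; (iii) for every $n \ge 1$ there is $C_n' > 0$ with $|q^{(n)}(x)| \le C_n' (1+q(x)) \langle x\rangle^{-n}$ for all $x \in \mathbb{R}$; (iv) there are $x_0, K > 0$ with $q(x) \le K a(x)$ for all $|x| > x_0$. For a function $m$ on $\mathbb{R}$ let $\operatorname{Dom}(m) := \{u \in L^2(\mathbb{R}) : mu \in L^2(\mathbb{R})\}$. In $L^2(\mathbb{R})$ let $H_q := -\partial_x^2 + q$ with $\operatorname{Dom}(H_q) := \{u \in W^{1,2}(\mathbb{R}) \cap \operatorname{Dom}(q^{1/2}) : -u''+qu \in L^2(\mathbb{R})\}$ (derivatives in the sense of distributions) and, for $\mu > 0$, let $T(\mu) := H_q + 2\mu a + \mu^2$ with $\operatorname{Dom}(T(\mu)) := \operatorname{Dom}(H_q)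 \cap \operatorname{Dom}(a)$. Then $\operatorname{Dom}(T(\mu)) = W^{2,2}(\mathbb{R}) \cap \operatorname{Dom}(a)$ for every $\mu > 0$; $H_q$ and $T(\mu)$ have non-negative self-adjoint square roots $H_q^{1/2}$ and $T(\mu)^{1/2}$; $T(\mu)$ and $T(\mu)^{1/2}$ are bijective from their domains onto $L^2(\mathbb{R})$, with inverses $T(\mu)^{-1}$ and $T(\mu)^{-1/2}$; $H_qT(\mu)^{-1}$, $H_q^{1/2}T(\mu)^{-1}$ and $H_q^{1/2}T(\mu)^{-1/2}$ are everywhere defined; and $T(\mu)^{-1}H_q$, $T(\mu)^{-1}H_q^{1/2}$ and $T(\mu)^{-1/2}H_q^{1/2}$ are densely defined. Moreover, there are constants $C, \mu_0 > 0$, depending only on $a$ and $q$, such that, with $\|\cdot\|$ denoting the $L^2(\mathbb{R})$ norm and, for a densely defined operator, the supremum of $\|Au\|$ over $u \in \operatorname{Dom}(A)$, $\|u\| \le 1$ (the norm of its bounded extension): 1. for all $\mu \ge \mu_0$ and $u \in \operatorname{Dom}(T(\mu))$, one has $u'', qu, au \in L^2(\mathbb{R})$ and $$\|u''\|^2 +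 \|qu\|^2 + \mu^2\|au\|^2 \le C\left(\|T(\mu)u\|^2 + \mu^2\|u\|^2\right);$$ 2. $\|T(\mu)^{-1}\| \le \mu^{-2}$ for all $\mu > 0$; 3. $\|H_qT(\mu)^{-1}\| + \|T(\mu)^{-1}H_q\| \le C$ for all $\mu \ge \mu_0$; 4. $\|H_q^{1/2}T(\mu)^{-1}\| + \|T(\mu)^{-1}H_q^{1/2}\| \le C\mu^{-1}$ for all $\mu \ge \mu_0$; 5. $\|H_q^{1/2}T(\mu)^{-1/2}\| + \|T(\mu)^{-1/2}H_q^{1/2}\| \le C$ for all $\mu > 0$. -/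

import Mathlib

noncomputable section

namespace DampedWave

open MeasureTheory Filter
open scoped ENNReal ContDiff

/-! ### Unbounded operators -/

section Operators

variable {E : Type*} [NormedAddCommGroup E] [InnerProductSpace ℂ E]

/-- The product `A B` of two unbounded operators on its natural domain
`{x ∈ Dom B : B x ∈ Dom A}`. -/
def opComp (A B : E →ₗ.[ℂ] E) : E →ₗ.[ℂ] E where
  domain := (A.domain.comap B.toFun).map B.domain.subtype
  toFun :=
    { toFun := fun x =>
        A ⟨B ⟨x, by obtain ⟨y, _, hy⟩ := x.2; exact hy ▸ y.2⟩, by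
          obtain ⟨x, y, hy, rfl⟩ := x
          exact hy⟩
      map_add' := fun x y => by
        rw [← LinearPMap.map_add]
        congr 1
        exact Subtype.ext (LinearPMap.map_add B ⟨x, _⟩ ⟨y, _⟩)
      map_smul' := fun c x => by
        rw [RingHom.id_apply, ← LinearPMap.map_smul]
        congr 1
        exact Subtype.ext (LinearPMap.map_smul B c ⟨x, _⟩) }

/-- The operator norm `sup {‖A x‖ : x ∈ Dom A, ‖x‖ ≤ 1} ∈ [0, ∞]`. For a densely defined `A` it is
finite exactly if `A` has a bounded extension to `E`, and is then the norm of that extension. -/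
def opNorm (A : E →ₗ.[ℂ] E) : ℝ≥0∞ :=
  ⨆ x : A.domain, ⨆ _ : ‖(x : E)‖ ≤ 1, ‖A x‖ₑ

/-- `B` is a non-negative self-adjoint square root of `A`. -/
structure IsPosSqrt [CompleteSpace E] (A B : E →ₗ.[ℂ] E) : Prop where
  selfAdjoint : IsSelfAdjoint B
  nonneg : ∀ x : B.domain, 0 ≤ (inner ℂ (x : E) (B x)).re
  sq : opComp B B = A

open Classical in
/-- `A^{1/2}`: the (unique) non-negative self-adjoint square root of `A`, which exists if `A` is
non-negative and self-adjoint; `0` if there is none. -/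
def posSqrt [CompleteSpace E] (A : E →ₗ.[ℂ] E) : E →ₗ.[ℂ] E :=
  if h : ∃ B, IsPosSqrt A B then h.choose else 0

end Operators

/-! ### Operators in `L²(ℝ)` -/

/-- The Hilbert space `L²(ℝ)` of complex-valued functions. -/
abbrev L2 : Type := Lp ℂ 2 (volume : Measure ℝ)

/-- `g` is the `n`-th weak (distributional) derivative of `u`, both being locally integrable. -/
structure HasWeakDeriv (n : ℕ) (u g : ℝ → ℂ) : Prop where
  left : LocallyIntegrable u
  right : LocallyIntegrable g
  eq : ∀ φ : ℝ → ℂ, ContDiff ℝ ∞ φ → HasCompactSupport φ →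
    ∫ x, u x * iteratedDeriv n φ x = (-1) ^ n * ∫ x, g x * φ x

lemma integrable_mul_test {u φ : ℝ → ℂ} (hu : LocallyIntegrable u) (h : Continuous φ)
    (hc : HasCompactSupport φ) : Integrable (fun x => u x * φ x) := by
  have := hu.integrable_smul_right_of_hasCompactSupport h hc
  simpa [smul_eq_mul] using this

lemma test_iteratedDeriv {φ : ℝ → ℂ} (n : ℕ) (h : ContDiff ℝ ∞ φ) (hc : HasCompactSupport φ) :
    Continuous (iteratedDeriv n φ) ∧ HasCompactSupport (iteratedDeriv n φ) := by
  refine ⟨h.continuous_iteratedDeriv n (by exact_mod_cast le_top), ?_⟩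
  induction n with
  | zero => simpa using hc
  | succ k ih => rw [iteratedDeriv_succ]; exact ih.deriv

lemma HasWeakDeriv.congr {n : ℕ} {u u' g g' : ℝ → ℂ} (h : HasWeakDeriv n u g)
    (hu : u =ᵐ[volume] u') (hg : g =ᵐ[volume] g') : HasWeakDeriv n u' g' where
  left := h.left.congr hu
  right := h.right.congr hg
  eq φ h1 h2 := by
    have e1 : ∫ x, u' x * iteratedDeriv n φ x = ∫ x, u x * iteratedDeriv n φ x :=
      integral_congr_ae (by filter_upwards [hu] with x hx using by rw [hx])
    have e2 : ∫ x, g' x * φ x = ∫ x, g x * φ x :=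
      integral_congr_ae (by filter_upwards [hg] with x hx using by rw [hx])
    rw [e1, e2, h.eq φ h1 h2]

lemma HasWeakDeriv.zero (n : ℕ) : HasWeakDeriv n 0 0 where
  left := locallyIntegrable_zero
  right := locallyIntegrable_zero
  eq := by simp

lemma HasWeakDeriv.add {n : ℕ} {u g u' g' : ℝ → ℂ} (h : HasWeakDeriv n u g)
    (h' : HasWeakDeriv n u' g') : HasWeakDeriv n (u + u') (g + g') where
  left := h.left.add h'.left
  right := h.right.add h'.right
  eq φ h1 h2 := by
    obtain ⟨c1, c2⟩ := test_iteratedDeriv n h1 h2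
    simp only [Pi.add_apply, add_mul]
    rw [integral_add (integrable_mul_test h.left c1 c2) (integrable_mul_test h'.left c1 c2),
      integral_add (integrable_mul_test h.right h1.continuous h2)
        (integrable_mul_test h'.right h1.continuous h2), h.eq φ h1 h2, h'.eq φ h1 h2, mul_add]

lemma HasWeakDeriv.smul {n : ℕ} {u g : ℝ → ℂ} (c : ℂ) (h : HasWeakDeriv n u g) :
    HasWeakDeriv n (c • u) (c • g) where
  left := h.left.smul c
  right := h.right.smul c
  eq φ h1 h2 := by
    simp only [Pi.smul_apply, smul_eq_mul, mul_assoc, integral_const_mul, h.eq φ h1 h2]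
    ring

/-- Weak derivatives are unique. -/
lemma HasWeakDeriv.eq_zero {n : ℕ} {u g : ℝ → ℂ} (h : HasWeakDeriv n u g)
    (hu : u =ᵐ[volume] 0) : g =ᵐ[volume] 0 := by
  have h0 := h.congr hu (EventuallyEq.refl _ g)
  refine ae_eq_zero_of_integral_contDiff_smul_eq_zero h.right fun φ h1 h2 => ?_
  have e := h0.eq (fun x => (φ x : ℂ)) (Complex.ofRealCLM.contDiff.comp h1)
    (h2.comp_left (g := fun y : ℝ => (y : ℂ)) Complex.ofReal_zero)
  simp only [Pi.zero_apply, zero_mul, integral_zero] at e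
  have e' : ∫ x, g x * (φ x : ℂ) = 0 := by
    rcases mul_eq_zero.mp e.symm with h | h
    · exact absurd h (pow_ne_zero _ (by norm_num))
    · exact h
  rw [← e']
  exact integral_congr_ae (Eventually.of_forall fun x => by simp [mul_comm])

/-- The graph of the maximal weak differentiation operator `u ↦ u⁽ⁿ⁾` in `L²(ℝ)`. -/
def weakDerivGraph (n : ℕ) : Submodule ℂ (L2 × L2) where
  carrier := {p | HasWeakDeriv n p.1 p.2}
  zero_mem' := (HasWeakDeriv.zero n).congr (Lp.coeFn_zero ℂ 2 volume).symm
    (Lp.coeFn_zero ℂ 2 volume).symm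
  add_mem' {p p'} h h' := (HasWeakDeriv.add h h').congr (Lp.coeFn_add p.1 p'.1).symm
    (Lp.coeFn_add p.2 p'.2).symm
  smul_mem' c p h := (HasWeakDeriv.smul c h).congr (Lp.coeFn_smul c p.1).symm
    (Lp.coeFn_smul c p.2).symm

/-- The operator `u ↦ u⁽ⁿ⁾` in `L²(ℝ)`, with domain all `u ∈ L²(ℝ)` whose `n`-th weak derivative
belongs to `L²(ℝ)`. -/
def weakDeriv (n : ℕ) : L2 →ₗ.[ℂ] L2 := (weakDerivGraph n).toLinearPMap

lemma weakDeriv_graph (n : ℕ) : (weakDeriv n).graph = weakDerivGraph n := by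
  refine Submodule.toLinearPMap_graph_eq _ fun p hp h0 => ?_
  have hp' : HasWeakDeriv n p.1 p.2 := hp
  rw [h0] at hp'
  exact (Lp.eq_zero_iff_ae_eq_zero).mpr (hp'.eq_zero (Lp.coeFn_zero ℂ 2 volume))

/-- The Sobolev space `W^{k,2}(ℝ)`. -/
def sobolev (k : ℕ) : Submodule ℂ L2 := ⨅ j : ℕ, ⨅ _ : j ≤ k, (weakDeriv j).domain

/-- The maximal domain `Dom(m) = {u ∈ L²(ℝ) : m u ∈ L²(ℝ)}` of multiplication by `m`. -/
def mulDomain (m : ℝ → ℝ) : Submodule ℂ L2 where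
  carrier := {u | MemLp (fun x => (m x : ℂ) * u x) 2 volume}
  zero_mem' := by
    refine (memLp_congr_ae ?_).mp (MemLp.zero (ε := ℂ) (p := 2) (μ := (volume : Measure ℝ)))
    filter_upwards [Lp.coeFn_zero ℂ 2 (volume : Measure ℝ)] with x hx
    simp only [hx, Pi.zero_apply, mul_zero]
  add_mem' {u v} hu hv := by
    refine (memLp_congr_ae ?_).mp (MemLp.add (Set.mem_ofPred.mp hu) (Set.mem_ofPred.mp hv))
    filter_upwards [Lp.coeFn_add u v] with x hx
    simp only [hx, Pi.add_apply, mul_add]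
  smul_mem' c u hu := by
    refine (memLp_congr_ae ?_).mp (MemLp.const_smul (Set.mem_ofPred.mp hu) c)
    filter_upwards [Lp.coeFn_smul c u] with x hx
    simp only [hx, Pi.smul_apply, smul_eq_mul, mul_left_comm]

lemma mem_mulDomain {m : ℝ → ℝ} {u : L2} :
    u ∈ mulDomain m ↔ MemLp (fun x => (m x : ℂ) * u x) 2 volume := Iff.rfl

/-- The maximal multiplication operator `u ↦ m u`, with domain `Dom(m)`. -/
def mulOp (m : ℝ → ℝ) : L2 →ₗ.[ℂ] L2 where
  domain := mulDomain m
  toFun :=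
    { toFun := fun u => MemLp.toLp (fun x => (m x : ℂ) * (u : L2) x) (mem_mulDomain.mp u.2)
      map_add' := fun u v => by
        rw [← MemLp.toLp_add]
        refine MemLp.toLp_congr _ _ ?_
        filter_upwards [Lp.coeFn_add (u : L2) v] with x hx
        simp only [Submodule.coe_add, hx, Pi.add_apply, mul_add]
      map_smul' := fun c u => by
        rw [RingHom.id_apply, ← MemLp.toLp_const_smul]
        refine MemLp.toLp_congr _ _ ?_
        filter_upwards [Lp.coeFn_smul c (u : L2)] with x hx
        simp only [Submodule.coe_smul, hx, Pi.smul_apply, smul_eq_mul, mul_left_comm] }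

/-- The graph of `H_q = -∂ₓ² + q`: the pairs `(u, f)` in `L²(ℝ)` with
`u ∈ W^{1,2}(ℝ) ∩ Dom(q^{1/2})` and `-u'' + q u = f` in the sense of distributions, i.e.
the second weak derivative of `u` is `q u - f`. -/
def schrodingerGraph (q : ℝ → ℝ) : Submodule ℂ (L2 × L2) where
  carrier := {p | p.1 ∈ sobolev 1 ∧ p.1 ∈ (mulOp fun x => √(q x)).domain ∧
    HasWeakDeriv 2 p.1 (fun x => (q x : ℂ) * p.1 x - p.2 x)}
  zero_mem' := ⟨zero_mem _, zero_mem _, (HasWeakDeriv.zero 2).congr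
    (Lp.coeFn_zero ℂ 2 volume).symm (by
      filter_upwards [Lp.coeFn_zero ℂ 2 (volume : Measure ℝ)] with x hx using by simp)⟩
  add_mem' {p p'} h h' := ⟨add_mem h.1 h'.1, add_mem h.2.1 h'.2.1,
    (HasWeakDeriv.add h.2.2 h'.2.2).congr (Lp.coeFn_add p.1 p'.1).symm (by
      filter_upwards [Lp.coeFn_add p.1 p'.1, Lp.coeFn_add p.2 p'.2] with x hx hx' using by
        simp only [Prod.fst_add, Prod.snd_add, hx, hx', Pi.add_apply]; ring)⟩
  smul_mem' c p h := ⟨Submodule.smul_mem _ c h.1, Submodule.smul_mem _ c h.2.1,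
    (HasWeakDeriv.smul c h.2.2).congr (Lp.coeFn_smul c p.1).symm (by
      filter_upwards [Lp.coeFn_smul c p.1, Lp.coeFn_smul c p.2] with x hx hx' using by
        simp only [Prod.smul_fst, Prod.smul_snd, hx, hx', Pi.smul_apply, smul_eq_mul]; ring)⟩

/-- `H_q = -∂ₓ² + q` with domain
`{u ∈ W^{1,2}(ℝ) ∩ Dom(q^{1/2}) : -u'' + q u ∈ L²(ℝ)}`. -/
def schrodinger (q : ℝ → ℝ) : L2 →ₗ.[ℂ] L2 := (schrodingerGraph q).toLinearPMap

lemma schrodinger_graph (q : ℝ → ℝ) : (schrodinger q).graph = schrodingerGraph q := by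
  refine Submodule.toLinearPMap_graph_eq _ fun p hp h0 => ?_
  have hp' := hp.2.2
  have hz : ((p.1 : L2) : ℝ → ℂ) =ᵐ[volume] 0 := by rw [h0]; exact Lp.coeFn_zero ℂ 2 volume
  refine (Lp.eq_zero_iff_ae_eq_zero).mpr ?_
  filter_upwards [hp'.eq_zero hz, hz] with x hx hx'
  simpa [hx'] using hx

/-- `T(μ) = H_q + 2 μ a + μ²`, with domain `Dom(H_q) ∩ Dom(a)`. -/
def quadOp (a q : ℝ → ℝ) (μ : ℝ) : L2 →ₗ.[ℂ] L2 :=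
  schrodinger q + (2 * μ : ℂ) • mulOp a + (μ ^ 2 : ℂ) • (LinearMap.id : L2 →ₗ[ℂ] L2).toPMap ⊤

/-! ### Assumptions on the damping and the potential -/

/-- The derivatives of `f` of each order `n ≥ 1` are bounded by `C_n (1 + f(x)) ⟨x⟩^{-n}`, where
`⟨x⟩ = (1 + x²)^{1/2}`. -/
def ControlledDerivatives (f : ℝ → ℝ) : Prop :=
  ∀ n : ℕ, 1 ≤ n → ∃ C : ℝ, 0 < C ∧ ∀ x : ℝ,
    |iteratedDeriv n f x| ≤ C * (1 + f x) * (√(1 + x ^ 2) ^ n)⁻¹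

/-- The standing assumptions on the damping `a` and the potential `q`. -/
structure Admissible (a q : ℝ → ℝ) : Prop where
  smooth_a : ContDiff ℝ ∞ a
  smooth_q : ContDiff ℝ ∞ q
  nonneg_a : ∀ x, 0 ≤ a x
  nonneg_q : ∀ x, 0 ≤ q x
  unbounded_a : Tendsto a (cocompact ℝ) atTop
  controlled_a : ControlledDerivatives a
  controlled_q : ControlledDerivatives q
  q_le_a : ∃ x₀ : ℝ, 0 < x₀ ∧ ∃ K : ℝ, 0 < K ∧ ∀ x : ℝ, x₀ < |x| → q x ≤ K * a x

end DampedWave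

end

open DampedWave

namespace DampedWave

open MeasureTheory Filter
open scoped ENNReal ContDiff Topology

/-! ### Unbounded operators through their graphs: resolvents, square roots, products with inverses
-/

section Abstract

variable {E : Type*} [NormedAddCommGroup E] [InnerProductSpace ℂ E]

/-! The operator `T(μ)` is itself a Schrödinger operator, with potential `Q = q + 2μa + μ²`
(`Admissible.quadOp_eq`), and everything rests on two inequalities for it.

The first is the form bound `⟨u, H_q u⟩ + μ²‖u‖² ≤ ⟨u, T(μ)u⟩` (`Admissible.form_le`). It gives
`μ²‖u‖ ≤ ‖T(μ)u‖`, hence the resolvent bound. Since `‖H_q^{1/2}u‖² = ⟨u, H_q u⟩ ≤ ‖u‖ ‖T(μ)u‖`, it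
gives the `μ⁻¹` bound, and since square roots respect the form order (`IsPosSqrt.le_of_form_le`), it
gives the bound for `H_q^{1/2} T(μ)^{-1/2}`.

The second is separation: `‖Qu‖² ≤ K(‖T(μ)u‖² + ‖u‖²)` with `K` independent of `μ`. The derivative
bounds on `a` and `q` give `|Q'| ≤ C(1 + Q)` uniformly in `μ`. Testing the equation against a
bounded regularization of `Qu` leaves only a commutator term, which this inequality absorbs
(`separation_regularized`, `separation`). As `q`, `2μa` and `μ²` are each at most `Q`, the
regularity estimate and the bound on `H_q T(μ)⁻¹` follow. The products in reverse order are bounded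
by duality (`product_inverse_bounds`).

Self-adjointness enters through maximality: `1 + H_Q` is onto, by an orthogonal projection in `L² ×
L² × L²` (`schrodinger_one_add_surjective`). A square root of a maximal non-negative `A` is read off
from its bounded resolvent `R = (1 + A)⁻¹`: its graph is `{(R^{1/2}w, (1 - R)^{1/2}w)}`
(`IsMaxNonneg.exists_isPosSqrt`). All of the analysis uses one integration by parts in `W^{1,2}`
(`inner_weakDeriv_add_inner`). -/

lemma mem_graph_opComp {A B : E →ₗ.[ℂ] E} {x z : E} :
    (x, z) ∈ (opComp A B).graph ↔ ∃ y, (x, y) ∈ B.graph ∧ (y, z) ∈ A.graph := by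
  constructor
  · intro h
    obtain ⟨⟨x', hx'⟩, rfl, rfl⟩ := (LinearPMap.mem_graph_iff _).mp h
    obtain ⟨y, hy, rfl⟩ := hx'
    exact ⟨B y, B.mem_graph y, A.mem_graph ⟨B y, hy⟩⟩
  · rintro ⟨y, hy, hz⟩
    obtain ⟨x', rfl, rfl⟩ := (LinearPMap.mem_graph_iff _).mp hy
    obtain ⟨y', hy', rfl⟩ := (LinearPMap.mem_graph_iff _).mp hz
    have hm : (x' : E) ∈ (opComp A B).domain := by
      refine ⟨x', ?_, rfl⟩
      change B x' ∈ A.domain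
      have : (y' : E) = B x' := hy'
      exact this ▸ y'.2
    refine (LinearPMap.mem_graph_iff _).mpr ⟨⟨x', hm⟩, rfl, ?_⟩
    change A _ = A _
    congr 1
    exact Subtype.ext hy'.symm

lemma mem_graph_inverse {A : E →ₗ.[ℂ] E} (hA : LinearMap.ker A.toFun = ⊥) {x y : E} :
    (x, y) ∈ A.inverse.graph ↔ (y, x) ∈ A.graph := by
  rw [LinearPMap.inverse_graph hA, Submodule.mem_map]
  constructor
  · rintro ⟨⟨p, r⟩, hp, he⟩
    simp only [LinearEquiv.coe_coe, LinearEquiv.prodComm_apply, Prod.swap_prod_mk,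
      Prod.mk.injEq] at he
    rw [← he.1, ← he.2]; exact hp
  · exact fun h => ⟨(y, x), h, rfl⟩

lemma opNorm_le {A : E →ₗ.[ℂ] E} {C : ℝ} (hC : 0 ≤ C)
    (h : ∀ x y, (x, y) ∈ A.graph → ‖y‖ ≤ C * ‖x‖) : opNorm A ≤ ENNReal.ofReal C := by
  refine iSup_le fun x => iSup_le fun hx => ?_
  rw [← ofReal_norm]
  refine ENNReal.ofReal_le_ofReal ((h _ _ (A.mem_graph x)).trans ?_)
  exact mul_le_of_le_one_right hC hx

lemma re_inner_self (z : E) : (inner ℂ z z).re = ‖z‖ ^ 2 := by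
  rw [inner_self_eq_norm_sq_to_K]; simp [← Complex.ofReal_pow]

/-- Symmetry of an unbounded operator, in terms of its graph. -/
def IsSymm (A : E →ₗ.[ℂ] E) : Prop :=
  ∀ x₁ y₁ x₂ y₂, (x₁, y₁) ∈ A.graph → (x₂, y₂) ∈ A.graph → inner ℂ y₁ x₂ = inner ℂ x₁ y₂

/-- A symmetric non-negative operator `A` such that `1 + A` is onto. -/
structure IsMaxNonneg (A : E →ₗ.[ℂ] E) : Prop where
  symm : IsSymm A
  nonneg : ∀ x y, (x, y) ∈ A.graph → 0 ≤ (inner ℂ x y).re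
  surj : ∀ f, ∃ x, (x, f - x) ∈ A.graph

/-- The resolvent `(1 + A)⁻¹`. -/
lemma IsMaxNonneg.exists_resolvent {A : E →ₗ.[ℂ] E} (hA : IsMaxNonneg A) :
    ∃ R : E →L[ℂ] E, 0 ≤ R ∧ 0 ≤ 1 - R ∧ Function.Injective R ∧
      ∀ x y, (x, y) ∈ A.graph ↔ ∃ f, x = R f ∧ y = f - R f := by
  choose r hr using hA.surj
  -- The difference `d` of two solutions satisfies `A d = -d`, which non-negativity allows only for
  -- `d = 0`.
  have uniq : ∀ f x, (x, f - x) ∈ A.graph → x = r f := by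
    intro f x hx
    have h := A.graph.sub_mem hx (hr f)
    have h' := hA.nonneg _ _ h
    have e : (f - x) - (f - r f) = -(x - r f) := by abel
    rw [e, inner_neg_right, inner_self_eq_norm_sq_to_K] at h'
    rw [← sub_eq_zero, ← norm_eq_zero]
    have : (0 : ℝ) ≤ -‖x - r f‖ ^ 2 := by
      simpa [← Complex.ofReal_pow] using h'
    nlinarith [norm_nonneg (x - r f)]
  let L : E →ₗ[ℂ] E :=
    { toFun := r
      map_add' := fun f g => (uniq _ _ (by
        have h := A.graph.add_mem (hr f) (hr g)
        simpa [add_sub_add_comm] using h)).symm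
      map_smul' := fun c f => (uniq _ _ (by
        have h := A.graph.smul_mem c (hr f)
        simpa [smul_sub] using h)).symm }
  -- This one inequality yields both the contraction bound and the positivity of the resolvent.
  have key : ∀ f, ‖r f‖ ^ 2 ≤ (inner ℂ (r f) f).re := by
    intro f
    have h' := hA.nonneg _ _ (hr f)
    rw [inner_sub_right, Complex.sub_re, re_inner_self] at h'
    linarith
  have bd : ∀ f, ‖L f‖ ≤ 1 * ‖f‖ := by
    intro f
    change ‖r f‖ ≤ _
    have h1 := key f
    have h2 : (inner ℂ (r f) f).re ≤ ‖r f‖ * ‖f‖ := re_inner_le_norm (𝕜 := ℂ) _ _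
    rcases (norm_nonneg (r f)).eq_or_lt with h | h
    · rw [← h]; positivity
    · nlinarith
  let R : E →L[ℂ] E := L.mkContinuous 1 bd
  have hR : ∀ f, R f = r f := fun f => rfl
  have symR : (R : E →ₗ[ℂ] E).IsSymmetric := by
    intro f g
    have h := hA.symm _ _ _ _ (hr f) (hr g)
    rw [inner_sub_left, inner_sub_right] at h
    change inner ℂ (r f) g = inner ℂ f (r g)
    linear_combination -h
  have posR : R.IsPositive := by
    refine ⟨symR, fun f => ?_⟩
    exact (sq_nonneg _).trans (key f)
  refine ⟨R, (ContinuousLinearMap.nonneg_iff_isPositive R).mpr posR,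
    (ContinuousLinearMap.nonneg_iff_isPositive _).mpr ⟨?_, fun f => ?_⟩, ?_, ?_⟩
  · intro f g
    have := symR f g
    simp only [ContinuousLinearMap.coe_coe] at this
    simp [inner_sub_left, inner_sub_right, this]
  · have h' := hA.nonneg _ _ (hr f)
    have h2 : (inner ℂ (f - r f) f).re = (inner ℂ (r f) (f - r f)).re + ‖f - r f‖ ^ 2 := by
      have e : (inner ℂ (f - r f) f).re = (inner ℂ f (f - r f)).re :=
        inner_re_symm (𝕜 := ℂ) (f - r f) f
      rw [← re_inner_self (f - r f), e]
      have : inner ℂ (f - r f) (f - r f) = inner ℂ f (f - r f) - inner ℂ (r f) (f - r f) :=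
        inner_sub_left _ _ _
      rw [this]; simp
    change 0 ≤ (inner ℂ (f - r f) f).re
    rw [h2]; positivity
  · intro f g hfg
    have h := A.graph.sub_mem (hr f) (hr g)
    rw [hR, hR] at hfg
    simp only [hfg, Prod.mk_sub_mk, sub_self] at h
    have := LinearPMap.graph_fst_eq_zero_snd _ h rfl
    simpa [sub_eq_zero] using this
  · intro x y
    constructor
    · intro h
      have : x = r (x + y) := uniq _ _ (by simpa using h)
      exact ⟨x + y, this, by rw [hR, ← this]; abel⟩
    · rintro ⟨f, rfl, rfl⟩
      exact hr f

lemma inverse_domain_eq_top {A : E →ₗ.[ℂ] E} (h : ∀ f, ∃ x, (x, f) ∈ A.graph) :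
    A.inverse.domain = ⊤ := by
  rw [LinearPMap.inverse_domain, eq_top_iff]
  intro f _
  obtain ⟨x, hx⟩ := h f
  obtain ⟨y, -, hy⟩ := (LinearPMap.mem_graph_iff _).mp hx
  exact ⟨y, hy⟩

lemma ker_eq_bot_of_graph {A : E →ₗ.[ℂ] E} (h : ∀ x, (x, 0) ∈ A.graph → x = 0) :
    LinearMap.ker A.toFun = ⊥ := by
  rw [Submodule.eq_bot_iff]
  intro x hx
  have hx' : A x = 0 := hx
  refine Subtype.ext (h x ?_)
  rw [← hx']
  exact A.mem_graph x

/-- If `T` is symmetric and bijective, `G` is symmetric and `‖G x‖ ≤ C ‖T x‖` on the domain of `T`,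
then `G T⁻¹` is everywhere defined, `T⁻¹ G` is defined on the domain of `G`, and both are bounded
by `C`. -/
lemma product_inverse_bounds {G T : E →ₗ.[ℂ] E} (hker : LinearMap.ker T.toFun = ⊥)
    (hsurj : ∀ f, ∃ x, (x, f) ∈ T.graph) (hT : IsSymm T) (hG : IsSymm G) {C : ℝ} (hC : 0 ≤ C)
    (hb : ∀ x f, (x, f) ∈ T.graph → ∃ g, (x, g) ∈ G.graph ∧ ‖g‖ ≤ C * ‖f‖) :
    (opComp G T.inverse).domain = ⊤ ∧ opNorm (opComp G T.inverse) ≤ ENNReal.ofReal C ∧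
      (opComp T.inverse G).domain = G.domain ∧
      opNorm (opComp T.inverse G) ≤ ENNReal.ofReal C := by
  refine ⟨?_, opNorm_le hC fun f g h => ?_, ?_, opNorm_le hC fun u z h => ?_⟩
  · rw [eq_top_iff]
    intro f _
    obtain ⟨x, hx⟩ := hsurj f
    obtain ⟨g, hg, -⟩ := hb x f hx
    exact LinearPMap.mem_domain_of_mem_graph
      (mem_graph_opComp.mpr ⟨x, (mem_graph_inverse hker).mpr hx, hg⟩)
  · obtain ⟨x, hx, hg⟩ := mem_graph_opComp.mp h
    obtain ⟨g', hg', hle⟩ := hb x f ((mem_graph_inverse hker).mp hx)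
    rwa [G.mem_graph_snd_inj hg hg' rfl]
  · ext u
    simp only [LinearPMap.mem_domain_iff, mem_graph_opComp]
    constructor
    · rintro ⟨_, y, hy, -⟩
      exact ⟨y, hy⟩
    · rintro ⟨y, hy⟩
      obtain ⟨x, hx⟩ := hsurj y
      exact ⟨x, y, hy, (mem_graph_inverse hker).mpr hx⟩
  · obtain ⟨g, hg, hz⟩ := mem_graph_opComp.mp h
    rw [mem_graph_inverse hker] at hz
    obtain ⟨x, hx⟩ := hsurj z
    obtain ⟨g', hg', hle⟩ := hb x z hx
    -- Duality without adjoints: with `T x = z` and `T z = G u`, symmetry moves `T` and then `G`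
    -- across, so the bound on `G x` controls `z = T⁻¹ G u`.
    have e : inner ℂ z z = inner ℂ g' u := by
      rw [hT _ _ _ _ hx hz, hG _ _ _ _ hg' hg]
    have h1 : ‖z‖ ^ 2 ≤ ‖g'‖ * ‖u‖ := by
      rw [← re_inner_self, e]
      exact re_inner_le_norm (𝕜 := ℂ) _ _
    rcases (norm_nonneg z).eq_or_lt with h0 | h0
    · rw [← h0]; positivity
    · have h2 : ‖g'‖ * ‖u‖ ≤ C * ‖z‖ * ‖u‖ := by gcongr
      nlinarith

variable [CompleteSpace E]

lemma mem_graph_iff_of_isSelfAdjoint {A : E →ₗ.[ℂ] E} (hA : IsSelfAdjoint A) {x y : E} :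
    (x, y) ∈ A.graph ↔ ∀ a b, (a, b) ∈ A.graph → inner ℂ b x = inner ℂ a y := by
  have h := LinearPMap.adjoint_graph_eq_graph_adjoint hA.dense_domain
  rw [LinearPMap.isSelfAdjoint_def.mp hA] at h
  conv_lhs => rw [h]
  simp only [Submodule.mem_adjoint_iff, sub_eq_zero]

lemma isSelfAdjoint_of_graph {A : E →ₗ.[ℂ] E} (hd : Dense (A.domain : Set E))
    (h : ∀ x y, (x, y) ∈ A.graph ↔ ∀ a b, (a, b) ∈ A.graph → inner ℂ b x = inner ℂ a y) :
    IsSelfAdjoint A := by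
  rw [LinearPMap.isSelfAdjoint_def]
  apply LinearPMap.eq_of_eq_graph
  rw [LinearPMap.adjoint_graph_eq_graph_adjoint hd]
  ext ⟨x, y⟩
  simp only [Submodule.mem_adjoint_iff, sub_eq_zero, h x y]

lemma isSymm_of_isSelfAdjoint {A : E →ₗ.[ℂ] E} (hA : IsSelfAdjoint A) : IsSymm A :=
  fun _ _ _ _ h h' => (mem_graph_iff_of_isSelfAdjoint hA).mp h' _ _ h

/-- The orthogonal complement of the range of a symmetric bounded operator is its kernel. -/
lemma dense_range_of_nonneg_of_injective {S : E →L[ℂ] E} (hS : 0 ≤ S)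
    (hi : Function.Injective S) : DenseRange S := by
  have hp := (ContinuousLinearMap.nonneg_iff_isPositive S).mp hS
  have h : (LinearMap.range (S : E →ₗ[ℂ] E)).topologicalClosure = ⊤ := by
    rw [Submodule.topologicalClosure_eq_top_iff, Submodule.eq_bot_iff]
    intro x hx
    have h0 : S x = 0 := by
      refine ext_inner_left ℂ fun v => ?_
      rw [← hp.inner_left_eq_inner_right, inner_zero_right]
      exact (Submodule.mem_orthogonal _ _).mp hx _ ⟨v, rfl⟩
    exact hi (by rw [h0, map_zero])
  exact (Submodule.dense_iff_topologicalClosure_eq_top).mpr h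

/-- A maximal non-negative operator has a non-negative self-adjoint square root. -/
theorem IsMaxNonneg.exists_isPosSqrt {A : E →ₗ.[ℂ] E} (hA : IsMaxNonneg A) :
    ∃ B, IsPosSqrt A B := by
  obtain ⟨R, hR, hR', hinj, hgr⟩ := hA.exists_resolvent
  -- Formally `A = (1 - R)R⁻¹`, so its root is `W S⁻¹`, encoded by the graph `{(Sw, Ww)}`. The
  -- fourth root `Q` serves only for non-negativity: `⟨Sw, Ww⟩ = ⟨Qw, W Qw⟩`.
  let S := CFC.sqrt R
  let W := CFC.sqrt (1 - R)
  let Q := CFC.sqrt S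
  have hSS : S * S = R := CFC.sqrt_mul_sqrt_self R hR
  have hWW : W * W = 1 - R := CFC.sqrt_mul_sqrt_self _ hR'
  have hQQ : Q * Q = S := CFC.sqrt_mul_sqrt_self _ (CFC.sqrt_nonneg R)
  have cRR : Commute R (1 - R) := (Commute.one_right R).sub_right (Commute.refl R)
  have cS : Commute S (1 - R) := cRR.cfcₙ_nnreal _
  have cQ : Commute Q (1 - R) := cS.cfcₙ_nnreal _
  have cSW : Commute S W := (cS.symm.cfcₙ_nnreal _).symm
  have cQW : Commute Q W := (cQ.symm.cfcₙ_nnreal _).symm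
  have pS := (ContinuousLinearMap.nonneg_iff_isPositive S).mp (CFC.sqrt_nonneg R)
  have pW := (ContinuousLinearMap.nonneg_iff_isPositive W).mp (CFC.sqrt_nonneg _)
  have pQ := (ContinuousLinearMap.nonneg_iff_isPositive Q).mp (CFC.sqrt_nonneg S)
  have aSS : ∀ x, S (S x) = R x := fun x => DFunLike.congr_fun hSS x
  have aWW : ∀ x, W (W x) = x - R x := fun x => DFunLike.congr_fun hWW x
  have aQQ : ∀ x, Q (Q x) = S x := fun x => DFunLike.congr_fun hQQ x
  have aSW : ∀ x, S (W x) = W (S x) := fun x => DFunLike.congr_fun cSW.eq x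
  have aQW : ∀ x, Q (W x) = W (Q x) := fun x => DFunLike.congr_fun cQW.eq x
  have iS : Function.Injective S := by
    intro x y h
    exact hinj (by rw [← aSS, ← aSS, h])
  let g : Submodule ℂ (E × E) := LinearMap.range ((S : E →ₗ[ℂ] E).prod (W : E →ₗ[ℂ] E))
  let B : E →ₗ.[ℂ] E := g.toLinearPMap
  have hB : ∀ x y, (x, y) ∈ B.graph ↔ ∃ w, S w = x ∧ W w = y := by
    intro x y
    have : B.graph = g := by
      refine Submodule.toLinearPMap_graph_eq _ ?_
      rintro ⟨a, b⟩ ⟨w, hw⟩ h0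
      have h1 : S w = a := congrArg Prod.fst hw
      have h2 : W w = b := congrArg Prod.snd hw
      have : w = 0 := iS (by rw [h1, map_zero]; exact h0)
      change b = 0
      rw [← h2, this, map_zero]
    rw [this]
    simp only [g, LinearMap.mem_range]
    exact exists_congr fun w => Prod.mk_inj
  -- Since `S² + W² = 1`, the graph of `B` is the whole solution set of `W x = S y`, with `w = Sx +
  -- Wy` recovering the parameter. This maximality gives both self-adjointness and `B² = A`.
  have hmax : ∀ x y, W x = S y → ∃ w, S w = x ∧ W w = y := by
    intro x y h
    refine ⟨S x + W y, ?_, ?_⟩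
    · rw [map_add, aSS, aSW, ← h, aWW]; abel
    · rw [map_add, aWW, ← aSW, h, aSS]; abel
  refine ⟨B, isSelfAdjoint_of_graph ?_ ?_, ?_, ?_⟩
  · have hd := dense_range_of_nonneg_of_injective (CFC.sqrt_nonneg R) iS
    refine Dense.mono ?_ hd
    rintro _ ⟨w, rfl⟩
    exact LinearPMap.mem_domain_of_mem_graph ((hB _ _).mpr ⟨w, rfl, rfl⟩)
  · intro x y
    constructor
    · intro h a b hab
      obtain ⟨w, rfl, rfl⟩ := (hB _ _).mp h
      obtain ⟨v, rfl, rfl⟩ := (hB _ _).mp hab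
      rw [pW.inner_left_eq_inner_right, pS.inner_left_eq_inner_right, aSW]
    · intro h
      rw [hB]
      refine hmax x y (ext_inner_left ℂ fun v => ?_)
      rw [← pW.inner_left_eq_inner_right, ← pS.inner_left_eq_inner_right]
      exact h _ _ ((hB _ _).mpr ⟨v, rfl, rfl⟩)
  · intro x
    obtain ⟨w, h1, h2⟩ := (hB _ _).mp (B.mem_graph x)
    rw [← h1, ← h2, pS.inner_left_eq_inner_right, ← aQQ, ← pQ.inner_left_eq_inner_right, aQW]
    exact pW.re_inner_nonneg_right (Q w)
  · apply LinearPMap.eq_of_eq_graph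
    ext ⟨x, z⟩
    rw [mem_graph_opComp, hgr]
    constructor
    · rintro ⟨y, h1, h2⟩
      obtain ⟨w, rfl, rfl⟩ := (hB _ _).mp h1
      obtain ⟨v, h3, rfl⟩ := (hB _ _).mp h2
      obtain ⟨t, rfl, rfl⟩ := hmax w v h3.symm
      exact ⟨t, aSS t, aWW t⟩
    · rintro ⟨f, rfl, rfl⟩
      exact ⟨W (S f), (hB _ _).mpr ⟨S f, aSS f, rfl⟩, (hB _ _).mpr ⟨W f, aSW f, aWW f⟩⟩

lemma IsMaxNonneg.isPosSqrt_posSqrt {A : E →ₗ.[ℂ] E} (hA : IsMaxNonneg A) :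
    IsPosSqrt A (posSqrt A) := by
  have h := hA.exists_isPosSqrt
  rw [posSqrt, dif_pos h]
  exact h.choose_spec

lemma IsMaxNonneg.dense_domain {A : E →ₗ.[ℂ] E} (hA : IsMaxNonneg A) :
    Dense (A.domain : Set E) := by
  obtain ⟨R, hR, -, hinj, hgr⟩ := hA.exists_resolvent
  refine Dense.mono ?_ (dense_range_of_nonneg_of_injective hR hinj)
  rintro _ ⟨w, rfl⟩
  exact LinearPMap.mem_domain_of_mem_graph ((hgr _ _).mpr ⟨w, rfl, rfl⟩)

/-- A maximal non-negative operator that is bounded below by a positive constant is onto. -/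
lemma IsMaxNonneg.surjective_of_coercive {A : E →ₗ.[ℂ] E} (hA : IsMaxNonneg A) {c : ℝ}
    (hc : 0 < c) (h : ∀ x y, (x, y) ∈ A.graph → c * ‖x‖ ^ 2 ≤ (inner ℂ x y).re) (f : E) :
    ∃ x, (x, f) ∈ A.graph := by
  obtain ⟨R, -, -, -, hgr⟩ := hA.exists_resolvent
  have hu : IsUnit (1 - R) := by
    -- With `x = Rw` and `y = (1 - R)w`, coercivity bounds `‖w‖² = ‖x‖² + 2 Re⟨x, y⟩ + ‖y‖²` by
    -- `(c⁻¹ + 2)(Re⟨x, y⟩ + ‖y‖²)`, and the last factor is `Re⟨(1 - R)w, w⟩`. Hence `1 - R` is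
    -- coercive and so invertible.
    have hk : 0 < (c⁻¹ + 2)⁻¹ := by positivity
    refine ContinuousLinearMap.isUnit_of_forall_le_norm_inner_map (𝕜 := ℂ) (1 - R)
      (c := ⟨(c⁻¹ + 2)⁻¹, hk.le⟩) hk fun w => ?_
    have h1 := h _ _ ((hgr _ _).mpr ⟨w, rfl, rfl⟩)
    set x := R w
    have e : (1 - R) w = w - x := rfl
    obtain ⟨y, hy⟩ : ∃ y, y = w - x := ⟨_, rfl⟩
    have hw : w = x + y := by rw [hy]; abel
    rw [e, ← hy]
    rw [← hy] at h1
    rw [hw]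
    refine le_trans ?_ (Complex.abs_re_le_norm _)
    refine le_trans ?_ (le_abs_self _)
    have e1 : (inner ℂ y (x + y)).re = (inner ℂ x y).re + ‖y‖ ^ 2 := by
      rw [inner_add_right, Complex.add_re, re_inner_self]
      congr 1
      exact inner_re_symm (𝕜 := ℂ) y x
    have e2 : ‖x + y‖ ^ 2 = ‖x‖ ^ 2 + 2 * (inner ℂ x y).re + ‖y‖ ^ 2 :=
      norm_add_sq (𝕜 := ℂ) x y
    rw [e1, e2]
    change (‖x‖ ^ 2 + 2 * (inner ℂ x y).re + ‖y‖ ^ 2) * (c⁻¹ + 2)⁻¹ ≤ _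
    rw [← div_eq_mul_inv, div_le_iff₀ (by positivity)]
    have h2 : ‖x‖ ^ 2 ≤ c⁻¹ * (inner ℂ x y).re := by
      rw [← div_eq_inv_mul, le_div_iff₀ hc]; linarith
    have h3 : 0 ≤ c⁻¹ * ‖y‖ ^ 2 := by positivity
    nlinarith [sq_nonneg ‖y‖]
  obtain ⟨w, hw⟩ := (ContinuousLinearMap.isUnit_iff_bijective.mp hu).2 f
  exact ⟨R w, (hgr _ _).mpr ⟨w, rfl, hw.symm⟩⟩

/-- The vector `z` is `A^{1/2} x`. The norm identity is what converts form inequalities for `A` into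
norm inequalities for its root. -/
lemma IsPosSqrt.exists_of_mem_graph {A B : E →ₗ.[ℂ] E} (hB : IsPosSqrt A B) {x y : E}
    (h : (x, y) ∈ A.graph) :
    ∃ z, (x, z) ∈ B.graph ∧ (z, y) ∈ B.graph ∧ ‖z‖ ^ 2 = (inner ℂ x y).re := by
  rw [← hB.sq, mem_graph_opComp] at h
  obtain ⟨z, hz, hy⟩ := h
  refine ⟨z, hz, hy, ?_⟩
  rw [← isSymm_of_isSelfAdjoint hB.selfAdjoint _ _ _ _ hz hy, re_inner_self]

/-- Square roots respect the order: if `H ≤ T` in the sense of forms on the domain of `T`, then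
`‖H^{1/2} x‖ ≤ ‖T^{1/2} x‖` on the domain of `T^{1/2}`. -/
lemma IsPosSqrt.le_of_form_le {H T D B : E →ₗ.[ℂ] E} (hD : IsPosSqrt H D) (hB : IsPosSqrt T B)
    {c : ℝ} (hc : 0 < c) (hcoer : ∀ x y, (x, y) ∈ T.graph → c * ‖x‖ ^ 2 ≤ (inner ℂ x y).re)
    (hsurj : ∀ f, ∃ x, (x, f) ∈ T.graph)
    (hle : ∀ x f, (x, f) ∈ T.graph →
      ∃ g, (x, g) ∈ H.graph ∧ (inner ℂ x g).re ≤ (inner ℂ x f).re) {x f : E}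
    (hx : (x, f) ∈ B.graph) : ∃ g, (x, g) ∈ D.graph ∧ ‖g‖ ≤ ‖f‖ := by
  have symB := isSymm_of_isSelfAdjoint hB.selfAdjoint
  have hBsurj : ∀ f, ∃ x, (x, f) ∈ B.graph := by
    intro f
    obtain ⟨x, hx⟩ := hsurj f
    obtain ⟨z, -, hz, -⟩ := hB.exists_of_mem_graph hx
    exact ⟨z, hz⟩
  -- The lower bound `c` for `T` becomes `√c` for `B`: solve `B w = x`, so that `T w = f`, and
  -- combine `‖x‖² = ⟨w, f⟩` with `c‖w‖ ≤ ‖f‖`.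
  have hbelow : ∀ x f, (x, f) ∈ B.graph → c * ‖x‖ ^ 2 ≤ ‖f‖ ^ 2 := by
    intro x f hx
    obtain ⟨w, hw⟩ := hBsurj x
    have hT : (w, f) ∈ T.graph := by
      rw [← hB.sq, mem_graph_opComp]; exact ⟨x, hw, hx⟩
    have h1 := hcoer w f hT
    have h2 : ‖x‖ ^ 2 = (inner ℂ w f).re := by rw [← symB _ _ _ _ hw hx, re_inner_self]
    have h3 : (inner ℂ w f).re ≤ ‖w‖ * ‖f‖ := re_inner_le_norm (𝕜 := ℂ) _ _
    rcases (norm_nonneg w).eq_or_lt with h0 | h0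
    · rw [← h0] at h3
      have : ‖x‖ ^ 2 = 0 := le_antisymm (by linarith) (sq_nonneg _)
      rw [this]; nlinarith [sq_nonneg ‖f‖]
    · have h4 : c * ‖w‖ ≤ ‖f‖ := by nlinarith
      have h5 : c * ‖x‖ ^ 2 ≤ c * ‖w‖ * ‖f‖ := by nlinarith
      nlinarith [norm_nonneg f]
  have hcomp : ∀ x f, (x, f) ∈ B.graph → f ∈ B.domain → ∃ g, (x, g) ∈ D.graph ∧ ‖g‖ ≤ ‖f‖ := by
    intro x f hx hf
    obtain ⟨y, hy⟩ := LinearPMap.mem_domain_iff.mp hf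
    have hT : (x, y) ∈ T.graph := by
      rw [← hB.sq, mem_graph_opComp]; exact ⟨f, hx, hy⟩
    obtain ⟨g, hg, hgle⟩ := hle x y hT
    obtain ⟨z, hz, -, hzn⟩ := hD.exists_of_mem_graph hg
    refine ⟨z, hz, abs_le_of_sq_le_sq' ?_ (norm_nonneg f) |>.2⟩
    rw [hzn, ← re_inner_self f, symB _ _ _ _ hx hy]
    exact hgle
  -- The comparison is known on `Dom T`, which is a core for `B`: approximate `f` by `s n ∈ Dom B`
  -- and solve `B (X n) = s n`, so that `X n ∈ Dom T`. Then `X n → x` by `hbelow`, the vectors `D (X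
  -- n)` are Cauchy by `hcomp`, and `D` is closed.
  have hdense := hB.selfAdjoint.dense_domain
  obtain ⟨s, hs, hlim⟩ := mem_closure_iff_seq_limit.mp (hdense f)
  choose X hX using fun n => hBsurj (s n)
  choose Y hY hYle using fun n => hcomp (X n) (s n) (hX n) (hs n)
  have hXlim : Tendsto X atTop (𝓝 x) := by
    rw [tendsto_iff_norm_sub_tendsto_zero]
    have hl : Tendsto (fun n => ‖s n - f‖ * (√c)⁻¹) atTop (𝓝 0) := by
      have := (tendsto_iff_norm_sub_tendsto_zero.mp hlim).mul_const (√c)⁻¹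
      simpa using this
    refine squeeze_zero (fun _ => norm_nonneg _) (fun n => ?_) hl
    have h1 := hbelow _ _ (B.graph.sub_mem (hX n) hx)
    rw [← div_eq_mul_inv, le_div_iff₀ (Real.sqrt_pos.mpr hc)]
    refine abs_le_of_sq_le_sq' ?_ (norm_nonneg _) |>.2
    rw [mul_pow, Real.sq_sqrt hc.le]
    linarith
  have hYc : CauchySeq Y := by
    have hsc := hlim.cauchySeq
    rw [Metric.cauchySeq_iff] at hsc ⊢
    intro ε hε
    obtain ⟨N, hN⟩ := hsc ε hε
    refine ⟨N, fun m hm n hn => lt_of_le_of_lt ?_ (hN m hm n hn)⟩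
    rw [dist_eq_norm, dist_eq_norm]
    obtain ⟨g, hg, hgle⟩ := hcomp _ _ (B.graph.sub_mem (hX m) (hX n)) (sub_mem (hs m) (hs n))
    have := D.mem_graph_snd_inj hg (D.graph.sub_mem (hY m) (hY n)) rfl
    change g = Y m - Y n at this
    rwa [← this]
  obtain ⟨g, hg⟩ := cauchySeq_tendsto_of_complete hYc
  refine ⟨g, ?_, le_of_tendsto_of_tendsto' hg.norm hlim.norm hYle⟩
  exact (hD.selfAdjoint.isClosed : IsClosed (D.graph : Set (E × E))).mem_of_tendsto
    (hXlim.prodMk_nhds hg) (Eventually.of_forall hY)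

end Abstract

/-! ### Weak derivatives on the line and integration by parts -/

section WeakDerivatives

lemma locallyIntegrable_L2 (u : L2) : LocallyIntegrable (u : ℝ → ℂ) :=
  (Lp.memLp u).locallyIntegrable one_le_two

lemma LocallyIntegrable.continuous_mul {u w : ℝ → ℂ} (hu : LocallyIntegrable u)
    (hw : Continuous w) : LocallyIntegrable fun x => w x * u x := by
  rw [MeasureTheory.locallyIntegrable_iff] at hu ⊢
  exact fun k hk => (hu k hk).continuousOn_mul hw.continuousOn hk

/-- Smooth compactly supported functions. -/
structure IsTest (φ : ℝ → ℂ) : Prop where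
  smooth : ContDiff ℝ ∞ φ
  compact : HasCompactSupport φ

namespace IsTest

variable {φ : ℝ → ℂ}

lemma derivative (h : IsTest φ) : IsTest (deriv φ) :=
  ⟨(contDiff_infty_iff_deriv.mp h.smooth).2, h.compact.deriv⟩

lemma memLp (h : IsTest φ) : MemLp φ 2 volume :=
  h.smooth.continuous.memLp_of_hasCompactSupport h.compact

lemma hasDerivAt (h : IsTest φ) (x : ℝ) : HasDerivAt φ (deriv φ x) x :=
  (contDiff_infty_iff_deriv.mp h.smooth).1.differentiableAt.hasDerivAt

lemma smooth_mul (h : IsTest φ) {w : ℝ → ℂ} (hw : ContDiff ℝ ∞ w) :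
    IsTest fun x => w x * φ x :=
  ⟨hw.mul h.smooth, h.compact.mul_left⟩

lemma conj (h : IsTest φ) : IsTest fun x => star (φ x) :=
  ⟨Complex.conjCLE.toContinuousLinearMap.contDiff.comp h.smooth,
    h.compact.comp_left (g := (star : ℂ → ℂ)) (star_zero ℂ)⟩

lemma integrable_mul (h : IsTest φ) {u : ℝ → ℂ} (hu : LocallyIntegrable u) :
    Integrable fun x => u x * φ x :=
  integrable_mul_test hu h.smooth.continuous h.compact

end IsTest

lemma deriv_star_test {φ : ℝ → ℂ} (h : IsTest φ) (x : ℝ) :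
    deriv (fun x => star (φ x)) x = star (deriv φ x) :=
  (h.hasDerivAt x).star.deriv

/-- The vector of `L²(ℝ)` representing the functional `u ↦ ∫ u φ`. -/
noncomputable def dualVec (φ : ℝ → ℂ) (h : MemLp φ 2 volume) : L2 := MemLp.toLp (star φ) h.star

lemma inner_dualVec (φ : ℝ → ℂ) (h : MemLp φ 2 volume) (u : L2) :
    inner ℂ (dualVec φ h) u = ∫ x, u x * φ x := by
  rw [L2.inner_def]
  refine integral_congr_ae ?_
  filter_upwards [MemLp.coeFn_toLp h.star] with x hx
  rw [dualVec, hx, RCLike.inner_apply]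
  simp

lemma hasWeakDeriv_one_iff {u g : ℝ → ℂ} : HasWeakDeriv 1 u g ↔ LocallyIntegrable u ∧
    LocallyIntegrable g ∧
    ∀ φ, IsTest φ → (∫ x, u x * deriv φ x) + ∫ x, g x * φ x = 0 := by
  constructor
  · intro h
    refine ⟨h.left, h.right, fun φ hφ => ?_⟩
    have := h.eq φ hφ.smooth hφ.compact
    rw [iteratedDeriv_one] at this
    rw [this]; ring
  · rintro ⟨h1, h2, h3⟩
    refine ⟨h1, h2, fun φ hs hc => ?_⟩
    rw [iteratedDeriv_one]
    linear_combination h3 φ ⟨hs, hc⟩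

lemma hasWeakDeriv_one_L2_iff {u g : L2} : HasWeakDeriv 1 u g ↔
    ∀ φ (h : IsTest φ),
      inner ℂ (dualVec (deriv φ) h.derivative.memLp) u + inner ℂ (dualVec φ h.memLp) g = 0 := by
  simp only [hasWeakDeriv_one_iff, locallyIntegrable_L2, true_and, inner_dualVec]

lemma IsTest.hasWeakDeriv {φ : ℝ → ℂ} (h : IsTest φ) : HasWeakDeriv 1 φ (deriv φ) := by
  rw [hasWeakDeriv_one_iff]
  refine ⟨h.smooth.continuous.locallyIntegrable, h.derivative.smooth.continuous.locallyIntegrable,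
    fun ψ hψ => ?_⟩
  have := integral_mul_deriv_eq_deriv_mul_of_integrable (u := φ) (v := ψ) (u' := deriv φ)
    (v' := deriv ψ) (fun x _ => h.hasDerivAt x) (fun x _ => hψ.hasDerivAt x)
    (hψ.derivative.integrable_mul h.smooth.continuous.locallyIntegrable)
    (hψ.integrable_mul h.derivative.smooth.continuous.locallyIntegrable)
    (hψ.integrable_mul h.smooth.continuous.locallyIntegrable)
  rw [this]; ring

lemma IsTest.hasWeakDeriv_dualVec {φ : ℝ → ℂ} (h : IsTest φ) :
    HasWeakDeriv 1 (dualVec φ h.memLp) (dualVec (deriv φ) h.derivative.memLp) := by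
  refine h.conj.hasWeakDeriv.congr (MemLp.coeFn_toLp h.memLp.star).symm ?_
  refine EventuallyEq.trans (Eventually.of_forall fun x => deriv_star_test h x)
    (MemLp.coeFn_toLp h.derivative.memLp.star).symm

/-- A test function with vanishing integral is the derivative of a test function. -/
lemma IsTest.exists_primitive {φ : ℝ → ℂ} (h : IsTest φ) (h0 : ∫ x, φ x = 0) :
    ∃ Φ, IsTest Φ ∧ deriv Φ = φ := by
  obtain ⟨R, hR⟩ := h.compact.isCompact.isBounded.subset_closedBall 0
  have hsupp : ∀ x, R < |x| → φ x = 0 := by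
    intro x hx
    by_contra hne
    have := hR (subset_tsupport _ hne)
    rw [Metric.mem_closedBall, dist_zero_right, Real.norm_eq_abs] at this
    linarith
  -- Strictly larger than `R`, so that the half-open interval `(-r, x]` contains the support as soon
  -- as `x > r`.
  set r := |R| + 1
  have hr : R < r := lt_of_le_of_lt (le_abs_self R) (lt_add_one _)
  have hr0 : 0 < r := by positivity
  let Φ : ℝ → ℂ := fun x => ∫ t in (-r)..x, φ t
  have hd : ∀ x, HasDerivAt Φ (φ x) x := fun x =>
    intervalIntegral.integral_hasDerivAt_right (h.smooth.continuous.intervalIntegrable _ _)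
      (h.smooth.continuous.stronglyMeasurableAtFilter _ _) h.smooth.continuous.continuousAt
  have hderiv : deriv Φ = φ := funext fun x => (hd x).deriv
  refine ⟨Φ, ⟨contDiff_infty_iff_deriv.mpr ⟨fun x => (hd x).differentiableAt, ?_⟩, ?_⟩, hderiv⟩
  · rw [hderiv]; exact h.smooth
  · refine HasCompactSupport.intro (isCompact_Icc (a := -r) (b := r)) fun x hx => ?_
    rw [Set.mem_Icc, not_and_or, not_le, not_le] at hx
    rcases hx with hx | hx
    · refine intervalIntegral.integral_zero_ae (Eventually.of_forall fun t ht => hsupp t ?_)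
      rw [Set.uIoc_of_ge hx.le] at ht
      have := neg_le_abs t
      linarith [ht.2]
    · change ∫ t in (-r)..x, φ t = 0
      rw [intervalIntegral.integral_eq_integral_of_support_subset, h0]
      intro t ht
      have h1 : |t| ≤ R := by
        by_contra hlt
        exact ht (hsupp t (not_le.mp hlt))
      have := abs_le.mp h1
      exact ⟨by linarith, by linarith⟩

/-- A locally integrable function with vanishing weak derivative is constant. -/
lemma HasWeakDeriv.exists_ae_eq_const {u : ℝ → ℂ} (h : HasWeakDeriv 1 u 0) :
    ∃ c : ℂ, u =ᵐ[volume] fun _ => c := by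
  obtain ⟨h1, -, h3⟩ := hasWeakDeriv_one_iff.mp h
  let b : ContDiffBump (0 : ℝ) := default
  let ψ : ℝ → ℂ := fun x => (b.normed volume x : ℂ)
  have hψ : IsTest ψ := ⟨Complex.ofRealCLM.contDiff.comp b.contDiff_normed,
    b.hasCompactSupport_normed.comp_left (g := fun y : ℝ => (y : ℂ)) Complex.ofReal_zero⟩
  have hψ1 : ∫ x, ψ x = 1 := by
    rw [integral_complex_ofReal, b.integral_normed, Complex.ofReal_one]
  set c := ∫ x, u x * ψ x with hc
  refine ⟨c, ?_⟩
  have hli : LocallyIntegrable (fun x => u x - c) := h1.sub continuous_const.locallyIntegrable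
  suffices (fun x => u x - c) =ᵐ[volume] 0 by
    filter_upwards [this] with x hx
    simpa [sub_eq_zero] using hx
  refine ae_eq_zero_of_integral_contDiff_smul_eq_zero hli fun φ hs hcs => ?_
  let θ : ℝ → ℂ := fun x => (φ x : ℂ)
  have hθ : IsTest θ := ⟨Complex.ofRealCLM.contDiff.comp hs,
    hcs.comp_left (g := fun y : ℝ => (y : ℂ)) Complex.ofReal_zero⟩
  have iθ : Integrable θ := hθ.smooth.continuous.integrable_of_hasCompactSupport hθ.compact
  have iψ : Integrable ψ := hψ.smooth.continuous.integrable_of_hasCompactSupport hψ.compact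
  set m := ∫ x, θ x
  -- Subtracting `m ψ` removes the mean of `θ`, so the difference is the derivative of a test
  -- function and is annihilated by `u`.
  have hf : IsTest fun x => θ x - m * ψ x :=
    ⟨hθ.smooth.sub (contDiff_const.mul hψ.smooth), hθ.compact.sub hψ.compact.mul_left⟩
  obtain ⟨Φ, hΦ, hd⟩ := hf.exists_primitive (by
    rw [integral_sub iθ (iψ.const_mul m), integral_const_mul, hψ1]; ring)
  have e := h3 Φ hΦ
  rw [hd] at e
  simp only [Pi.zero_apply, zero_mul, integral_zero, add_zero, mul_sub] at e
  rw [integral_sub (hθ.integrable_mul h1) (by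
    simpa [mul_left_comm] using (hψ.integrable_mul h1).const_mul m)] at e
  have e2 : ∫ x, u x * (m * ψ x) = m * c := by
    rw [hc, ← integral_const_mul]
    exact integral_congr_ae (Eventually.of_forall fun x => by ring)
  rw [e2] at e
  calc ∫ x, φ x • (u x - c) = ∫ x, (u x * θ x - c * θ x) :=
        integral_congr_ae (Eventually.of_forall fun x => by simp [θ]; ring)
    _ = 0 := by
        rw [integral_sub (hθ.integrable_mul h1) (iθ.const_mul c), integral_const_mul]
        linear_combination e

/-- The product rule for weak derivatives. -/
lemma HasWeakDeriv.smooth_mul {u g : ℝ → ℂ} (h : HasWeakDeriv 1 u g) {w : ℝ → ℝ}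
    (hw : ContDiff ℝ ∞ w) :
    HasWeakDeriv 1 (fun x => (w x : ℂ) * u x)
      (fun x => ((deriv w x : ℝ) : ℂ) * u x + (w x : ℂ) * g x) := by
  obtain ⟨h1, h2, h3⟩ := hasWeakDeriv_one_iff.mp h
  have hw' := contDiff_infty_iff_deriv.mp hw
  have cw : ContDiff ℝ ∞ fun x => (w x : ℂ) := Complex.ofRealCLM.contDiff.comp hw
  have cw' : Continuous fun x => ((deriv w x : ℝ) : ℂ) :=
    Complex.continuous_ofReal.comp hw'.2.continuous
  have l1 := h1.continuous_mul cw.continuous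
  have l2 := h1.continuous_mul cw'
  have l3 := h2.continuous_mul cw.continuous
  rw [hasWeakDeriv_one_iff]
  refine ⟨l1, l2.add l3, fun φ hφ => ?_⟩
  have e := h3 _ (hφ.smooth_mul cw)
  have hd : ∀ x, deriv (fun x => (w x : ℂ) * φ x) x =
      ((deriv w x : ℝ) : ℂ) * φ x + (w x : ℂ) * deriv φ x := fun x =>
    ((hw'.1.differentiableAt.hasDerivAt.ofReal_comp).mul (hφ.hasDerivAt x)).deriv
  have e1 : ∫ x, u x * deriv (fun x => (w x : ℂ) * φ x) x =
      (∫ x, ((deriv w x : ℝ) : ℂ) * u x * φ x) + ∫ x, (w x : ℂ) * u x * deriv φ x := by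
    rw [← integral_add (hφ.integrable_mul l2) (hφ.derivative.integrable_mul l1)]
    exact integral_congr_ae (Eventually.of_forall fun x => by simp only [hd]; ring)
  have e2 : ∫ x, g x * ((w x : ℂ) * φ x) = ∫ x, (w x : ℂ) * g x * φ x :=
    integral_congr_ae (Eventually.of_forall fun x => by ring)
  rw [e1, e2] at e
  simp only [add_mul]
  rw [integral_add (hφ.integrable_mul l2) (hφ.integrable_mul l3)]
  linear_combination e

/-- The equation `w' = σ w` with `σ ≠ 0` has no non-trivial solution in `L²(ℝ)`. -/
lemma eq_zero_of_hasWeakDeriv_self {σ : ℝ} (hσ : σ ≠ 0) {w : L2}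
    (h : HasWeakDeriv 1 w (fun x => (σ : ℂ) * w x)) : w = 0 := by
  have hexp : ContDiff ℝ ∞ fun x : ℝ => Real.exp (-(σ * x)) := by fun_prop
  have hd : ∀ x : ℝ, deriv (fun x : ℝ => Real.exp (-(σ * x))) x = -(σ * Real.exp (-(σ * x))) := by
    intro x
    have h1 : HasDerivAt (fun x : ℝ => -(σ * x)) (-(σ * 1)) x :=
      ((hasDerivAt_id x).const_mul σ).neg
    rw [h1.exp.deriv]; ring
  have h0 := (h.smooth_mul hexp).congr (EventuallyEq.refl _ _) (g' := 0)
    (Eventually.of_forall fun x => by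
      simp only [hd, Pi.zero_apply]; push_cast; ring)
  obtain ⟨c, hc⟩ := h0.exists_ae_eq_const
  by_cases hc0 : c = 0
  · rw [Lp.eq_zero_iff_ae_eq_zero]
    filter_upwards [hc] with x hx
    rw [hc0] at hx
    exact (mul_eq_zero.mp hx).resolve_left (by exact_mod_cast (Real.exp_pos _).ne')
  · exfalso
    have hlt := (Lp.memLp w).meas_ge_lt_top (p := 2) two_ne_zero ENNReal.ofNat_ne_top
      (ε := ‖c‖₊) (by simpa using hc0)
    -- A non-zero constant `c = e^{-σx} w` would force `|w| ≥ |c|` on the half-line `σx ≥ 0`, which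
    -- has infinite measure.
    have hle : volume {x : ℝ | 0 ≤ σ * x} ≤ volume {x : ℝ | ‖c‖₊ ≤ ‖w x‖₊} := by
      refine measure_mono_ae ?_
      filter_upwards [hc] with x hx h0x
      change ‖c‖ ≤ ‖w x‖
      change 0 ≤ σ * x at h0x
      have : ‖c‖ = Real.exp (-(σ * x)) * ‖w x‖ := by
        rw [← hx, norm_mul, Complex.norm_real, Real.norm_eq_abs, Real.abs_exp]
      rw [this]
      exact mul_le_of_le_one_left (norm_nonneg _) (Real.exp_le_one_iff.mpr (by linarith))
    have htop : volume {x : ℝ | 0 ≤ σ * x} = ⊤ := by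
      rcases lt_or_gt_of_ne hσ with hs | hs
      · have : {x : ℝ | 0 ≤ σ * x} = Set.Iic 0 := by
          ext x; simp only [Set.mem_ofPred_eq, Set.mem_Iic]
          constructor <;> intro hx <;> nlinarith
        rw [this, Real.volume_Iic]
      · have : {x : ℝ | 0 ≤ σ * x} = Set.Ici 0 := by
          ext x; simp only [Set.mem_ofPred_eq, Set.mem_Ici]
          constructor <;> intro hx <;> nlinarith
        rw [this, Real.volume_Ici]
    rw [htop] at hle
    exact absurd (lt_of_le_of_lt hle hlt) (lt_irrefl _)

lemma mem_orthogonal_span_iff {F : Type*} [NormedAddCommGroup F] [InnerProductSpace ℂ F]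
    {s : Set F} {x : F} : x ∈ (Submodule.span ℂ s)ᗮ ↔ ∀ y ∈ s, inner ℂ y x = 0 := by
  rw [Submodule.mem_orthogonal]
  refine ⟨fun h y hy => h y (Submodule.subset_span hy), fun h y hy => ?_⟩
  induction hy using Submodule.span_induction with
  | mem y hy => exact h y hy
  | zero => exact inner_zero_left _
  | add y z _ _ hy hz => rw [inner_add_left, hy, hz, add_zero]
  | smul c y _ hy => rw [inner_smul_left, hy, mul_zero]

/-- Integration by parts in `W^{1,2}(ℝ)`. -/
theorem inner_weakDeriv_add_inner {v v' b b' : L2} (hv : HasWeakDeriv 1 v v')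
    (hb : HasWeakDeriv 1 b b') : inner ℂ v' b + inner ℂ v b' = 0 := by
  let F := WithLp 2 (L2 × L2)
  -- `K` is the graph of differentiation on test functions and `G` the graph of the weak derivative.
  -- The aim is that `K` is dense in `G`. The functional `(v, v') ↦ ⟨v, b'⟩ + ⟨v', b⟩` vanishes on
  -- `K` up to conjugation, hence then on `G`.
  let K : Submodule ℂ F := Submodule.span ℂ
    {p | ∃ φ, ∃ h : IsTest φ,
      p = WithLp.toLp 2 (dualVec φ h.memLp, dualVec (deriv φ) h.derivative.memLp)}
  let G : Submodule ℂ F := (Submodule.span ℂ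
    {p | ∃ φ, ∃ h : IsTest φ,
      p = WithLp.toLp 2 (dualVec (deriv φ) h.derivative.memLp, dualVec φ h.memLp)})ᗮ
  have hK : ∀ p : F, p ∈ Kᗮ ↔ HasWeakDeriv 1 p.snd p.fst := by
    intro p
    rw [mem_orthogonal_span_iff, hasWeakDeriv_one_L2_iff]
    constructor
    · intro h φ hφ
      have := h _ ⟨φ, hφ, rfl⟩
      rw [WithLp.prod_inner_apply] at this
      rw [add_comm]; exact this
    · rintro h _ ⟨φ, hφ, rfl⟩
      rw [WithLp.prod_inner_apply, add_comm]
      exact h φ hφ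
  have hG : ∀ p : F, p ∈ G ↔ HasWeakDeriv 1 p.fst p.snd := by
    intro p
    rw [mem_orthogonal_span_iff, hasWeakDeriv_one_L2_iff]
    constructor
    · intro h φ hφ
      have := h _ ⟨φ, hφ, rfl⟩
      rwa [WithLp.prod_inner_apply] at this
    · rintro h _ ⟨φ, hφ, rfl⟩
      rw [WithLp.prod_inner_apply]
      exact h φ hφ
  have hKG : K.topologicalClosure ≤ G := by
    refine Submodule.topologicalClosure_minimal _ ?_ (Submodule.isClosed_orthogonal _)
    refine Submodule.span_le.mpr ?_
    rintro _ ⟨φ, hφ, rfl⟩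
    exact (hG _).mpr hφ.hasWeakDeriv_dualVec
  have : CompleteSpace K.topologicalClosure := K.isClosed_topologicalClosure.completeSpace_coe
  have hvK : WithLp.toLp 2 (v, v') ∈ K.topologicalClosure := by
    obtain ⟨k, hk, m, hm, e⟩ :=
      K.topologicalClosure.exists_add_mem_mem_orthogonal (WithLp.toLp 2 (v, v'))
    rw [Submodule.orthogonal_closure, hK] at hm
    have hmG : m ∈ G := by
      have : m = WithLp.toLp 2 (v, v') - k := by rw [e]; abel
      rw [this]
      exact G.sub_mem ((hG _).mpr hv) (hKG hk)
    rw [hG] at hmG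
    -- A vector `m` of `G` orthogonal to `K` has `m.fst' = m.snd` and `m.snd' = m.fst`, so the
    -- combinations with `σ = ±1` solve `w' = σ w` and vanish.
    have hz : ∀ σ : ℝ, σ ≠ 0 → σ * σ = 1 → m.fst + (σ : ℂ) • m.snd = 0 := by
      intro σ hσ hσ1
      have hσ1' : (σ : ℂ) * σ = 1 := by exact_mod_cast hσ1
      refine eq_zero_of_hasWeakDeriv_self hσ ?_
      refine (hmG.add (hm.smul (σ : ℂ))).congr ?_ ?_
      · filter_upwards [Lp.coeFn_add m.fst ((σ : ℂ) • m.snd), Lp.coeFn_smul (σ : ℂ) m.snd]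
          with x h1 h2
        rw [h1, Pi.add_apply, Pi.add_apply, h2]
      · filter_upwards [Lp.coeFn_add m.fst ((σ : ℂ) • m.snd), Lp.coeFn_smul (σ : ℂ) m.snd]
          with x h1 h2
        rw [h1, Pi.add_apply, Pi.add_apply, h2]
        simp only [Pi.smul_apply, smul_eq_mul]
        linear_combination (-m.snd x) * hσ1'
    have z1 := hz 1 one_ne_zero (by norm_num)
    have z2 := hz (-1) (by norm_num) (by norm_num)
    simp only [Complex.ofReal_one, one_smul, Complex.ofReal_neg, neg_smul] at z1 z2
    have h1 : m.fst = 0 := by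
      have : (2 : ℂ) • m.fst = 0 := by
        rw [two_smul]
        calc m.fst + m.fst = (m.fst + m.snd) + (m.fst + -m.snd) := by abel
          _ = 0 := by rw [z1, z2, add_zero]
      simpa using this
    have h2 : m.snd = 0 := by simpa [h1] using z1
    have hm0 : m = 0 := by
      apply (WithLp.equiv 2 (L2 × L2)).injective
      exact Prod.ext h1 h2
    rw [e, hm0, add_zero]
    exact hk
  have hbK : WithLp.toLp 2 (b', b) ∈ K.topologicalClosureᗮ := by
    rw [Submodule.orthogonal_closure, hK]
    exact hb
  have := (Submodule.mem_orthogonal _ _).mp hbK _ hvK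
  rw [WithLp.prod_inner_apply] at this
  rw [add_comm]
  exact this

end WeakDerivatives

/-! ### Multiplication operators -/

section Multiplication

lemma mem_mulDomain_of_le {m m' : ℝ → ℝ} (hm : Continuous m) {A B : ℝ}
    (h : ∀ x, |m x| ≤ A + B * |m' x|) {u : L2} (hu : u ∈ mulDomain m') : u ∈ mulDomain m := by
  rw [mem_mulDomain] at hu ⊢
  refine MemLp.mono' (((Lp.memLp u).norm.const_mul A).add (hu.norm.const_mul B)) ?_ ?_
  · exact (Complex.continuous_ofReal.comp hm).aestronglyMeasurable.mul (Lp.aestronglyMeasurable u)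
  · refine Eventually.of_forall fun x => ?_
    simp only [Pi.add_apply, norm_mul, Complex.norm_real, Real.norm_eq_abs]
    nlinarith [mul_le_mul_of_nonneg_right (h x) (norm_nonneg (u x))]

lemma mem_mulDomain_of_bounded {m : ℝ → ℝ} (hm : Continuous m) {A : ℝ} (h : ∀ x, |m x| ≤ A)
    (u : L2) : u ∈ mulDomain m := by
  refine mem_mulDomain_of_le (m' := 0) hm (A := A) (B := 0) (fun x => by simpa using h x) ?_
  rw [mem_mulDomain]
  simp

lemma coeFn_mulOp {m : ℝ → ℝ} {u : L2} (h : u ∈ (mulOp m).domain) :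
    mulOp m ⟨u, h⟩ =ᵐ[volume] fun x => (m x : ℂ) * u x :=
  MemLp.coeFn_toLp (mem_mulDomain.mp h)

lemma inner_mulOp_right {m : ℝ → ℝ} {u : L2} (h : u ∈ (mulOp m).domain) (v : L2) :
    inner ℂ v (mulOp m ⟨u, h⟩) = ∫ x, (m x : ℂ) * inner ℂ (v x) (u x) := by
  rw [L2.inner_def]
  refine integral_congr_ae ?_
  filter_upwards [coeFn_mulOp h] with x hx
  rw [hx, RCLike.inner_apply, RCLike.inner_apply, mul_assoc]

lemma inner_mulOp_mulOp {m m' : ℝ → ℝ} {u v : L2} (h : u ∈ (mulOp m).domain)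
    (h' : v ∈ (mulOp m').domain) :
    inner ℂ (mulOp m' ⟨v, h'⟩) (mulOp m ⟨u, h⟩) =
      ∫ x, ((m' x * m x : ℝ) : ℂ) * inner ℂ (v x) (u x) := by
  rw [L2.inner_def]
  refine integral_congr_ae ?_
  filter_upwards [coeFn_mulOp h, coeFn_mulOp h'] with x hx hx'
  rw [hx, hx', RCLike.inner_apply, RCLike.inner_apply, map_mul, Complex.conj_ofReal]
  push_cast
  ring

lemma inner_mulOp_left {m : ℝ → ℝ} {v : L2} (h : v ∈ (mulOp m).domain) (u : L2) :
    inner ℂ (mulOp m ⟨v, h⟩) u = ∫ x, (m x : ℂ) * inner ℂ (v x) (u x) := by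
  rw [L2.inner_def]
  refine integral_congr_ae ?_
  filter_upwards [coeFn_mulOp h] with x hx
  rw [hx, RCLike.inner_apply, RCLike.inner_apply, map_mul, Complex.conj_ofReal]
  ring

lemma tendsto_integral_mul_of_bounded {F : ℝ → ℂ} (hF : Integrable F) {m : ℕ → ℝ → ℝ}
    (hm : ∀ n, Continuous (m n)) {M c : ℝ} (hb : ∀ n x, |m n x| ≤ M)
    (hl : ∀ x, Tendsto (fun n => m n x) atTop (𝓝 c)) :
    Tendsto (fun n => ∫ x, (m n x : ℂ) * F x) atTop (𝓝 ((c : ℂ) * ∫ x, F x)) := by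
  rw [← integral_const_mul]
  refine tendsto_integral_of_dominated_convergence (fun x => M * ‖F x‖) (fun n => ?_)
    (hF.norm.const_mul M) (fun n => Eventually.of_forall fun x => ?_)
    (Eventually.of_forall fun x => ?_)
  · exact (Complex.continuous_ofReal.comp (hm n)).aestronglyMeasurable.mul
      hF.aestronglyMeasurable
  · rw [norm_mul, Complex.norm_real, Real.norm_eq_abs]
    exact mul_le_mul_of_nonneg_right (hb n x) (norm_nonneg _)
  · exact ((Complex.continuous_ofReal.tendsto c).comp (hl x)).mul_const _

end Multiplication

/-! ### Sobolev spaces and the Schrödinger graph as a first-order system -/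

section Domains

lemma mem_weakDeriv_graph {n : ℕ} {u g : L2} :
    (u, g) ∈ (weakDeriv n).graph ↔ HasWeakDeriv n u g := by
  rw [weakDeriv_graph]; rfl

lemma mem_weakDeriv_domain {n : ℕ} {u : L2} :
    u ∈ (weakDeriv n).domain ↔ ∃ g : L2, HasWeakDeriv n u g := by
  simp only [LinearPMap.mem_domain_iff, mem_weakDeriv_graph]

lemma mem_weakDeriv_zero_domain (u : L2) : u ∈ (weakDeriv 0).domain :=
  mem_weakDeriv_domain.mpr ⟨u, locallyIntegrable_L2 u, locallyIntegrable_L2 u, fun φ _ _ => by simp⟩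

lemma mem_sobolev_one {u : L2} : u ∈ sobolev 1 ↔ ∃ g : L2, HasWeakDeriv 1 u g := by
  rw [← mem_weakDeriv_domain, sobolev]
  simp only [Submodule.mem_iInf]
  refine ⟨fun h => h 1 le_rfl, fun h j hj => ?_⟩
  interval_cases j
  · exact mem_weakDeriv_zero_domain u
  · exact h

lemma mem_sobolev_two {u : L2} : u ∈ sobolev 2 ↔
    (∃ g : L2, HasWeakDeriv 1 u g) ∧ ∃ g : L2, HasWeakDeriv 2 u g := by
  rw [← mem_weakDeriv_domain, ← mem_weakDeriv_domain, sobolev]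
  simp only [Submodule.mem_iInf]
  refine ⟨fun h => ⟨h 1 one_le_two, h 2 le_rfl⟩, fun h j hj => ?_⟩
  interval_cases j
  · exact mem_weakDeriv_zero_domain u
  · exact h.1
  · exact h.2

/-- Test the first-order relation with `φ'`. It lets every second-order statement be treated by
first-order integration by parts. -/
lemma HasWeakDeriv.two_iff {u u' g : ℝ → ℂ} (h : HasWeakDeriv 1 u u') :
    HasWeakDeriv 2 u g ↔ HasWeakDeriv 1 u' g := by
  obtain ⟨h1, h2, h3⟩ := hasWeakDeriv_one_iff.mp h
  have e : ∀ φ : ℝ → ℂ, iteratedDeriv 2 φ = deriv (deriv φ) := fun φ => by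
    rw [iteratedDeriv_succ, iteratedDeriv_one]
  rw [hasWeakDeriv_one_iff]
  constructor
  · intro h'
    refine ⟨h2, h'.right, fun φ hφ => ?_⟩
    have e1 := h3 _ hφ.derivative
    have e2 := h'.eq φ hφ.smooth hφ.compact
    rw [e] at e2
    linear_combination e1 - e2
  · rintro ⟨-, hg, h'⟩
    refine ⟨h1, hg, fun φ hs hc => ?_⟩
    have e1 := h3 _ (IsTest.derivative ⟨hs, hc⟩)
    have e2 := h' φ ⟨hs, hc⟩
    rw [e]
    linear_combination e1 - e2

lemma mem_schrodinger_graph {q : ℝ → ℝ} {u f : L2} :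
    (u, f) ∈ (schrodinger q).graph ↔ u ∈ (mulOp fun x => √(q x)).domain ∧ ∃ u' : L2,
      HasWeakDeriv 1 u u' ∧ HasWeakDeriv 1 u' (fun x => (q x : ℂ) * u x - f x) := by
  rw [schrodinger_graph]
  constructor
  · rintro ⟨h1, h2, h3⟩
    obtain ⟨u', hu'⟩ := mem_sobolev_one.mp h1
    exact ⟨h2, u', hu', hu'.two_iff.mp h3⟩
  · rintro ⟨h2, u', hu', h3⟩
    exact ⟨mem_sobolev_one.mpr ⟨u', hu'⟩, h2, hu'.two_iff.mpr h3⟩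

end Domains

/-! ### The quadratic form of the Schrödinger operator and its maximality -/

section Form

/-- Smooth cutoff functions that increase to `1`, with derivatives tending to `0`. -/
lemma exists_cutoff : ∃ (χ : ℕ → ℝ → ℝ) (M : ℝ), (∀ n, ContDiff ℝ ∞ (χ n)) ∧
    (∀ n, HasCompactSupport (χ n)) ∧ (∀ n x, |χ n x| ≤ 1) ∧
    (∀ x, Tendsto (fun n => χ n x) atTop (𝓝 1)) ∧ (∀ n x, |deriv (χ n) x| ≤ M) ∧
    ∀ x, Tendsto (fun n => deriv (χ n) x) atTop (𝓝 0) := by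
  let b : ContDiffBump (0 : ℝ) := default
  have hb : ContDiff ℝ ∞ b := b.contDiff
  have hb' := contDiff_infty_iff_deriv.mp hb
  obtain ⟨M, hM⟩ := hb'.2.continuous.bounded_above_of_compact_support b.hasCompactSupport.deriv
  have hM0 : 0 ≤ M := (norm_nonneg _).trans (hM 0)
  have hs : ∀ n : ℕ, (0 : ℝ) < (n + 1 : ℝ)⁻¹ := fun n => by positivity
  have hs1 : ∀ n : ℕ, (n + 1 : ℝ)⁻¹ ≤ 1 := fun n => inv_le_one_of_one_le₀ (by
    have : (0 : ℝ) ≤ n := n.cast_nonneg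
    linarith)
  have ht : Tendsto (fun n : ℕ => (n + 1 : ℝ)⁻¹) atTop (𝓝 0) := by
    simpa [one_div] using tendsto_one_div_add_atTop_nhds_zero_nat (𝕜 := ℝ)
  have hd : ∀ n : ℕ, ∀ x : ℝ, deriv (fun x => b ((n + 1 : ℝ)⁻¹ * x)) x =
      (n + 1 : ℝ)⁻¹ * deriv b ((n + 1 : ℝ)⁻¹ * x) := by
    intro n x
    have := deriv_comp_mul_left (n + 1 : ℝ)⁻¹ (fun y => b y) x
    simpa using this
  refine ⟨fun n x => b ((n + 1 : ℝ)⁻¹ * x), M, fun n => ?_, fun n => ?_, fun n x => ?_,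
    fun x => ?_, fun n x => ?_, fun x => ?_⟩
  · exact hb.comp (contDiff_const.mul contDiff_id)
  · exact b.hasCompactSupport.comp_homeomorph (Homeomorph.mulLeft₀ _ (hs n).ne')
  · rw [abs_of_nonneg b.nonneg]; exact b.le_one
  · have h1 : Tendsto (fun n : ℕ => (n + 1 : ℝ)⁻¹ * x) atTop (𝓝 0) := by
      simpa using ht.mul_const x
    have h2 := (hb.continuous.tendsto 0).comp h1
    rwa [show b (0 : ℝ) = 1 from b.one_of_mem_closedBall
      (Metric.mem_closedBall_self b.rIn_pos.le)] at h2
  · rw [hd, abs_mul, abs_of_pos (hs n)]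
    exact (mul_le_of_le_one_left (abs_nonneg _) (hs1 n)).trans (hM _)
  · simp only [hd]
    refine squeeze_zero_norm (a := fun n : ℕ => (n + 1 : ℝ)⁻¹ * M) (fun n => ?_)
      (by simpa using ht.mul_const M)
    rw [norm_mul, Real.norm_of_nonneg (hs n).le]
    exact mul_le_mul_of_nonneg_left (hM _) (hs n).le

/-- The form identity `⟨v', u'⟩ + ⟨√q v, √q u⟩ = ⟨v, H_q u⟩`. -/
theorem form_identity {q : ℝ → ℝ} (hq : Continuous q) (hq0 : ∀ x, 0 ≤ q x) {u u' f v v' : L2}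
    (hu : u ∈ (mulOp fun x => √(q x)).domain)
    (huf : HasWeakDeriv 1 u' (fun x => (q x : ℂ) * u x - f x))
    (hv : v ∈ (mulOp fun x => √(q x)).domain) (hv' : HasWeakDeriv 1 v v') :
    inner ℂ v' u' + inner ℂ (mulOp (fun x => √(q x)) ⟨v, hv⟩) (mulOp (fun x => √(q x)) ⟨u, hu⟩) =
      inner ℂ v f := by
  obtain ⟨χ, M, hs, hc, h1, hl, hM, hl'⟩ := exists_cutoff
  have hcont := fun n => (hs n).continuous
  have hcont' := fun n => (contDiff_infty_iff_deriv.mp (hs n)).2.continuous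
  have hqc : ∀ n, Continuous fun x => χ n x * q x := fun n => (hcont n).mul hq
  have d1 : ∀ n (w : L2), w ∈ (mulOp (χ n)).domain := fun n w =>
    mem_mulDomain_of_bounded (hcont n) (h1 n) w
  have d2 : ∀ n (w : L2), w ∈ (mulOp (deriv (χ n))).domain := fun n w =>
    mem_mulDomain_of_bounded (hcont' n) (hM n) w
  have d3 : ∀ n (w : L2), w ∈ (mulOp fun x => χ n x * q x).domain := fun n w => by
    obtain ⟨C, hC⟩ := (hqc n).bounded_above_of_compact_support (hc n).mul_right
    exact mem_mulDomain_of_bounded (hqc n) hC w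
  -- Neither `q u` nor the weak derivative of `u'` is known to lie in `L²`, so `v` is paired with `χ
  -- n u'`, whose derivative `χ n' u' + χ n (q u - f)` does. The cutoff is removed by dominated
  -- convergence.
  have key : ∀ n, inner ℂ v' (mulOp (χ n) ⟨u', d1 n u'⟩) +
      (inner ℂ v (mulOp (deriv (χ n)) ⟨u', d2 n u'⟩) +
        inner ℂ v (mulOp (fun x => χ n x * q x) ⟨u, d3 n u⟩) -
        inner ℂ v (mulOp (χ n) ⟨f, d1 n f⟩)) = 0 := by
    intro n
    rw [← inner_add_right, ← inner_sub_right]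
    refine inner_weakDeriv_add_inner hv' ((huf.smooth_mul (hs n)).congr
      (coeFn_mulOp (d1 n u')).symm ?_)
    filter_upwards [coeFn_mulOp (d2 n u'), coeFn_mulOp (d3 n u), coeFn_mulOp (d1 n f),
      Lp.coeFn_add (mulOp (deriv (χ n)) ⟨u', d2 n u'⟩) (mulOp (fun x => χ n x * q x) ⟨u, d3 n u⟩),
      Lp.coeFn_sub (mulOp (deriv (χ n)) ⟨u', d2 n u'⟩ + mulOp (fun x => χ n x * q x) ⟨u, d3 n u⟩)
        (mulOp (χ n) ⟨f, d1 n f⟩)] with x e1 e2 e3 e4 e5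
    rw [e5, Pi.sub_apply, e4, Pi.add_apply, e1, e2, e3]
    push_cast
    ring
  have lim1 := tendsto_integral_mul_of_bounded (L2.integrable_inner (𝕜 := ℂ) v' u') hcont h1 hl
  have lim2 := tendsto_integral_mul_of_bounded (L2.integrable_inner (𝕜 := ℂ) v u') hcont' hM hl'
  have lim3 := tendsto_integral_mul_of_bounded (L2.integrable_inner (𝕜 := ℂ)
    (mulOp (fun x => √(q x)) ⟨v, hv⟩) (mulOp (fun x => √(q x)) ⟨u, hu⟩)) hcont h1 hl
  have lim4 := tendsto_integral_mul_of_bounded (L2.integrable_inner (𝕜 := ℂ) v f) hcont h1 hl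
  -- Splitting `q` as `√q √q` exhibits the integrable majorant `|√q v| |√q u|`.
  have e3 : ∀ n, ∫ x, (χ n x : ℂ) * inner ℂ (mulOp (fun x => √(q x)) ⟨v, hv⟩ x)
      (mulOp (fun x => √(q x)) ⟨u, hu⟩ x) =
        inner ℂ v (mulOp (fun x => χ n x * q x) ⟨u, d3 n u⟩) := by
    intro n
    rw [inner_mulOp_right]
    refine integral_congr_ae ?_
    filter_upwards [coeFn_mulOp hu, coeFn_mulOp hv] with x e1 e2
    rw [e1, e2, RCLike.inner_apply, RCLike.inner_apply, map_mul, Complex.conj_ofReal]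
    have : ((q x : ℝ) : ℂ) = (√(q x) : ℂ) * (√(q x) : ℂ) := by
      rw [← Complex.ofReal_mul, Real.mul_self_sqrt (hq0 x)]
    push_cast
    rw [this]
    ring
  simp only [e3] at lim3
  simp only [← inner_mulOp_right (d1 _ _)] at lim1 lim4
  simp only [← inner_mulOp_right (d2 _ _)] at lim2
  have lim := lim1.add ((lim2.add lim3).sub lim4)
  simp only [key] at lim
  have := tendsto_nhds_unique lim tendsto_const_nhds
  simp only [← L2.inner_def] at this
  simp only [Complex.ofReal_one, one_mul, Complex.ofReal_zero, zero_mul, zero_add] at this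
  linear_combination this

/-- For every `f` there is `u` with `u + H_q u = f`. -/
theorem schrodinger_one_add_surjective {q : ℝ → ℝ} (hq : Continuous q) (hq0 : ∀ x, 0 ≤ q x)
    (f : L2) : ∃ u, (u, f - u) ∈ (schrodinger q).graph := by
  let F := WithLp 2 (L2 × WithLp 2 (L2 × L2))
  let mk : L2 → L2 → L2 → F := fun x y z => WithLp.toLp 2 (x, WithLp.toLp 2 (y, z))
  have inner_mk : ∀ x y z (p : F), inner ℂ (mk x y z) p =
      inner ℂ x p.fst + (inner ℂ y p.snd.fst + inner ℂ z p.snd.snd) := by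
    intro x y z p
    rw [WithLp.prod_inner_apply, WithLp.prod_inner_apply]
    rfl
  have hsq : Continuous fun x => (√(q x) : ℂ) :=
    Complex.continuous_ofReal.comp (Real.continuous_sqrt.comp hq)
  have hmem : ∀ φ, IsTest φ → MemLp (fun x => (√(q x) : ℂ) * φ x) 2 volume := fun φ h =>
    (hsq.mul h.smooth.continuous).memLp_of_hasCompactSupport h.compact.mul_left
  let s : Set F := {p | (∃ φ, ∃ h : IsTest φ,
      p = mk (dualVec (deriv φ) h.derivative.memLp) (dualVec φ h.memLp) 0) ∨
    ∃ φ, ∃ h : IsTest φ, p = mk (dualVec _ (hmem φ h)) 0 (-dualVec φ h.memLp)}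
  -- `G` is the space of triples `(u, u', √q u)`, the form domain with its form norm. Written as an
  -- orthogonal complement, it is closed without further argument.
  let G : Submodule ℂ F := (Submodule.span ℂ s)ᗮ
  have hG : ∀ p : F, p ∈ G ↔ HasWeakDeriv 1 p.fst p.snd.fst ∧
      p.snd.snd =ᵐ[volume] fun x => (√(q x) : ℂ) * p.fst x := by
    intro p
    rw [mem_orthogonal_span_iff, hasWeakDeriv_one_L2_iff]
    have hli : LocallyIntegrable fun x => (√(q x) : ℂ) * p.fst x :=
      (locallyIntegrable_L2 p.fst).continuous_mul hsq
    constructor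
    · intro h
      refine ⟨fun φ hφ => ?_, ?_⟩
      · have := h _ (Or.inl ⟨φ, hφ, rfl⟩)
        rwa [inner_mk, inner_zero_left, add_zero] at this
      · suffices (fun x => p.snd.snd x - (√(q x) : ℂ) * p.fst x) =ᵐ[volume] 0 by
          filter_upwards [this] with x hx
          simpa [sub_eq_zero] using hx
        refine ae_eq_zero_of_integral_contDiff_smul_eq_zero
          ((locallyIntegrable_L2 _).sub hli) fun φ h1 h2 => ?_
        have hθ : IsTest fun x => (φ x : ℂ) := ⟨Complex.ofRealCLM.contDiff.comp h1,
          h2.comp_left (g := fun y : ℝ => (y : ℂ)) Complex.ofReal_zero⟩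
        have := h _ (Or.inr ⟨_, hθ, rfl⟩)
        rw [inner_mk, inner_zero_left, inner_neg_left, inner_dualVec, inner_dualVec] at this
        have e : ∫ x, φ x • (p.snd.snd x - (√(q x) : ℂ) * p.fst x) =
            (∫ x, p.snd.snd x * (φ x : ℂ)) - ∫ x, p.fst x * ((√(q x) : ℂ) * (φ x : ℂ)) := by
          rw [← integral_sub (hθ.integrable_mul (locallyIntegrable_L2 _))]
          · exact integral_congr_ae (Eventually.of_forall fun x => by
              simp only [Complex.real_smul]; ring)
          · exact (hθ.integrable_mul hli).congr (Eventually.of_forall fun x => by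
              simp only; ring)
        rw [e]
        linear_combination -this
    · rintro ⟨h1, h2⟩ y (⟨φ, hφ, rfl⟩ | ⟨φ, hφ, rfl⟩)
      · rw [inner_mk, inner_zero_left, add_zero]
        exact h1 φ hφ
      · rw [inner_mk, inner_zero_left, inner_neg_left, inner_dualVec, inner_dualVec]
        have e : ∫ x, p.snd.snd x * φ x = ∫ x, p.fst x * ((√(q x) : ℂ) * φ x) := by
          refine integral_congr_ae ?_
          filter_upwards [h2] with x hx
          rw [hx]; ring
        rw [e]; ring
  have : CompleteSpace G := (Submodule.isClosed_orthogonal _).completeSpace_coe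
  have : G.HasOrthogonalProjection := Submodule.HasOrthogonalProjection.ofCompleteSpace G
  -- For the projection `k = (u, u', √q u)` of `(f, 0, 0)`, orthogonality of the remainder `(f - u,
  -- -u', -√q u)` to `G` is the weak form of `u + H_q u = f`.
  obtain ⟨k, hk, m, hm, e⟩ := G.exists_add_mem_mem_orthogonal (mk f 0 0)
  obtain ⟨k1, k2⟩ := (hG k).mp hk
  have hm' : m = mk f 0 0 - k := by rw [e]; abel
  refine ⟨k.fst, mem_schrodinger_graph.mpr ⟨?_, k.snd.fst, k1, ?_⟩⟩
  · exact mem_mulDomain.mpr ((memLp_congr_ae k2).mp (Lp.memLp _))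
  · have hli : LocallyIntegrable fun x => (q x : ℂ) * k.fst x :=
      (locallyIntegrable_L2 k.fst).continuous_mul (Complex.continuous_ofReal.comp hq)
    rw [hasWeakDeriv_one_iff]
    refine ⟨locallyIntegrable_L2 _, hli.sub (locallyIntegrable_L2 _), fun φ hφ => ?_⟩
    have hin : mk (dualVec φ hφ.memLp) (dualVec (deriv φ) hφ.derivative.memLp)
        (dualVec _ (hmem φ hφ)) ∈ G := by
      refine (hG _).mpr ⟨hφ.hasWeakDeriv_dualVec, ?_⟩
      filter_upwards [MemLp.coeFn_toLp (hmem φ hφ).star, MemLp.coeFn_toLp hφ.memLp.star]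
        with x h1 h2
      change dualVec _ (hmem φ hφ) x = _ * dualVec φ hφ.memLp x
      rw [dualVec, dualVec, h1, h2]
      simp
    have e1 := (Submodule.mem_orthogonal _ _).mp hm _ hin
    rw [hm', inner_mk] at e1
    have f1 : (mk f 0 0 - k).fst = f - k.fst := rfl
    have f2 : (mk f 0 0 - k).snd.fst = 0 - k.snd.fst := rfl
    have f3 : (mk f 0 0 - k).snd.snd = 0 - k.snd.snd := rfl
    rw [f1, f2, f3, zero_sub, zero_sub, inner_neg_right, inner_neg_right, inner_dualVec,
      inner_dualVec, inner_dualVec] at e1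
    have e2 : ∫ x, k.snd.snd x * ((√(q x) : ℂ) * φ x) = ∫ x, (q x : ℂ) * k.fst x * φ x := by
      refine integral_congr_ae ?_
      filter_upwards [k2] with x hx
      have : ((q x : ℝ) : ℂ) = (√(q x) : ℂ) * (√(q x) : ℂ) := by
        rw [← Complex.ofReal_mul, Real.mul_self_sqrt (hq0 x)]
      rw [hx, this]; ring
    simp only [sub_mul]
    rw [integral_sub (hφ.integrable_mul hli) (hφ.integrable_mul (locallyIntegrable_L2 _))]
    rw [e2] at e1
    linear_combination -e1

lemma schrodinger_re_inner {q : ℝ → ℝ} (hq : Continuous q) (hq0 : ∀ x, 0 ≤ q x) {u u' f : L2}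
    (hu : u ∈ (mulOp fun x => √(q x)).domain) (hu' : HasWeakDeriv 1 u u')
    (huf : HasWeakDeriv 1 u' (fun x => (q x : ℂ) * u x - f x)) :
    (inner ℂ u f).re = ‖u'‖ ^ 2 + ‖mulOp (fun x => √(q x)) ⟨u, hu⟩‖ ^ 2 := by
  rw [← form_identity hq hq0 hu huf hu hu', Complex.add_re, re_inner_self, re_inner_self]

theorem isMaxNonneg_schrodinger {q : ℝ → ℝ} (hq : Continuous q) (hq0 : ∀ x, 0 ≤ q x) :
    IsMaxNonneg (schrodinger q) := by
  refine ⟨?_, ?_, schrodinger_one_add_surjective hq hq0⟩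
  · intro u f v g hu hv
    obtain ⟨hu1, u', hu', huf⟩ := mem_schrodinger_graph.mp hu
    obtain ⟨hv1, v', hv', hvg⟩ := mem_schrodinger_graph.mp hv
    rw [← form_identity hq hq0 hv1 hvg hu1 hu', ← inner_conj_symm,
      ← form_identity hq hq0 hu1 huf hv1 hv', map_add, inner_conj_symm, inner_conj_symm]
  · intro u f hu
    obtain ⟨hu1, u', hu', huf⟩ := mem_schrodinger_graph.mp hu
    rw [schrodinger_re_inner hq hq0 hu1 hu' huf]
    positivity

end Form

/-! ### The separation estimate -/

section Separation

lemma norm_sq_eq_integral (f : L2) : ‖f‖ ^ 2 = ∫ x, ‖f x‖ ^ 2 := by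
  rw [← re_inner_self, L2.inner_def]
  have : ∀ x, inner ℂ (f x) (f x) = ((‖f x‖ ^ 2 : ℝ) : ℂ) := fun x => by
    rw [inner_self_eq_norm_sq_to_K]; simp
  simp only [this]
  rw [integral_complex_ofReal, Complex.ofReal_re]

lemma integrable_norm_sq (f : L2) : Integrable fun x => ‖f x‖ ^ 2 :=
  (Lp.memLp f).norm.integrable_sq

lemma norm_mulOp_sq_le {m m' : ℝ → ℝ} {A B : ℝ} (h : ∀ x, m x ^ 2 ≤ A + B * m' x ^ 2) {u : L2}
    (hm : u ∈ (mulOp m).domain) (hm' : u ∈ (mulOp m').domain) :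
    ‖mulOp m ⟨u, hm⟩‖ ^ 2 ≤ A * ‖u‖ ^ 2 + B * ‖mulOp m' ⟨u, hm'⟩‖ ^ 2 := by
  simp only [norm_sq_eq_integral]
  rw [← integral_const_mul, ← integral_const_mul,
    ← integral_add ((integrable_norm_sq _).const_mul _) ((integrable_norm_sq _).const_mul _)]
  refine integral_mono_ae (integrable_norm_sq _) (((integrable_norm_sq _).const_mul _).add
    ((integrable_norm_sq _).const_mul _)) ?_
  filter_upwards [coeFn_mulOp hm, coeFn_mulOp hm'] with x e1 e2
  rw [e1, e2, norm_mul, norm_mul, Complex.norm_real, Complex.norm_real, mul_pow, mul_pow,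
    Real.norm_eq_abs, Real.norm_eq_abs, sq_abs, sq_abs]
  nlinarith [mul_le_mul_of_nonneg_right (h x) (sq_nonneg ‖u x‖)]

lemma re_inner_mulOp_self_nonneg {m : ℝ → ℝ} (hm : ∀ x, 0 ≤ m x) {u : L2}
    (h : u ∈ (mulOp m).domain) : 0 ≤ (inner ℂ u (mulOp m ⟨u, h⟩)).re := by
  rw [inner_mulOp_right]
  have : ∀ x, (m x : ℂ) * inner ℂ (u x) (u x) = ((m x * ‖u x‖ ^ 2 : ℝ) : ℂ) := fun x => by
    rw [inner_self_eq_norm_sq_to_K]; simp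
  simp only [this]
  rw [integral_complex_ofReal, Complex.ofReal_re]
  exact integral_nonneg fun x => mul_nonneg (hm x) (sq_nonneg _)

/-- The regularized separation estimate, with the weight `Q / (1 + δ Q)` in place of `Q`. -/
lemma separation_regularized {Q : ℝ → ℝ} (hQ : ContDiff ℝ ∞ Q) (hQ0 : ∀ x, 0 ≤ Q x) {C : ℝ}
    (hC : 0 ≤ C) (hQ' : ∀ x, |deriv Q x| ≤ C * (1 + Q x)) {u f : L2}
    (huf : (u, f) ∈ (schrodinger Q).graph) {δ : ℝ} (hδ : 0 < δ) :
    ∃ h : u ∈ (mulOp fun x => Q x / √(1 + δ * Q x)).domain,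
      ‖mulOp (fun x => Q x / √(1 + δ * Q x)) ⟨u, h⟩‖ ^ 2 ≤
        (4 * C ^ 2 + 7) * (‖f‖ ^ 2 + ‖u‖ ^ 2) := by
  obtain ⟨hu, u', hu', huf'⟩ := mem_schrodinger_graph.mp huf
  have hQd := contDiff_infty_iff_deriv.mp hQ
  have hD : ∀ x, 1 ≤ 1 + δ * Q x := fun x => by nlinarith [mul_nonneg hδ.le (hQ0 x)]
  have hDpos : ∀ x, 0 < 1 + δ * Q x := fun x => one_pos.trans_le (hD x)
  -- The weight `w` approximates `Q` but is bounded by `δ⁻¹`, so `w u` may be used as a test vector.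
  -- The function `s` is the square root of `Q w`.
  let w : ℝ → ℝ := fun x => Q x / (1 + δ * Q x)
  let s : ℝ → ℝ := fun x => Q x / √(1 + δ * Q x)
  have hDs : ContDiff ℝ ∞ fun x => 1 + δ * Q x := contDiff_const.add (contDiff_const.mul hQ)
  have hw : ContDiff ℝ ∞ w := hQ.div hDs fun x => (hDpos x).ne'
  have hs : Continuous s := hQ.continuous.div (Real.continuous_sqrt.comp hDs.continuous)
    fun x => (Real.sqrt_pos.mpr (hDpos x)).ne'
  have hw0 : ∀ x, 0 ≤ w x := fun x => div_nonneg (hQ0 x) (hDpos x).le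
  have hss : ∀ x, s x * s x = Q x * w x := fun x => by
    simp only [s, w]
    rw [div_mul_div_comm, Real.mul_self_sqrt (hDpos x).le]
    ring
  have hwQ : ∀ x, w x ≤ Q x := fun x => div_le_self (hQ0 x) (hD x)
  have hwδ : ∀ x, w x ≤ δ⁻¹ := fun x => by
    rw [div_le_iff₀ (hDpos x), mul_add, mul_one, inv_mul_cancel_left₀ hδ.ne']
    linarith [inv_pos.mpr hδ]
  have hdw : ∀ x, deriv w x = deriv Q x / (1 + δ * Q x) ^ 2 := fun x => by
    have h1 := hQd.1.differentiableAt.hasDerivAt (x := x)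
    have h2 := h1.div ((h1.const_mul δ).const_add 1) (hDpos x).ne'
    rw [show deriv w x = _ from h2.deriv]
    congr 1
    ring
  -- Uniform in `δ`: `(1 + Q)² ≤ 2(1 + Q²)` and `Q² = Q w (1 + δQ)`, while the denominator `(1 +
  -- δQ)⁴` of `w'²` absorbs the extra factor `1 + δQ`.
  have hdwb : ∀ x, deriv w x ^ 2 ≤ 2 * C ^ 2 + 2 * C ^ 2 * s x ^ 2 := fun x => by
    rw [hdw, sq (s x), hss, div_pow, ← sq_abs (deriv Q x),
      div_le_iff₀ (pow_pos (pow_pos (hDpos x) 2) 2)]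
    have h1 : |deriv Q x| ^ 2 ≤ C ^ 2 * (1 + Q x) ^ 2 := by
      rw [← mul_pow]; exact pow_le_pow_left₀ (abs_nonneg _) (hQ' x) 2
    refine h1.trans ?_
    have h2 : Q x * w x * (1 + δ * Q x) = Q x ^ 2 := by
      have := (hDpos x).ne'
      simp only [w]; rw [mul_assoc, div_mul_cancel₀ _ this, sq]
    have h3 : 1 + δ * Q x ≤ ((1 + δ * Q x) ^ 2) ^ 2 := by
      rw [← pow_mul]; exact le_self_pow₀ (hD x) (by norm_num)
    have h4 : (1 + Q x) ^ 2 ≤ 2 * (1 + Q x * w x) * ((1 + δ * Q x) ^ 2) ^ 2 := by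
      have h5 : 0 ≤ Q x * w x := mul_nonneg (hQ0 x) (hw0 x)
      have h6 : 2 * (1 + Q x * w x) * (1 + δ * Q x) ≤
          2 * (1 + Q x * w x) * ((1 + δ * Q x) ^ 2) ^ 2 :=
        mul_le_mul_of_nonneg_left h3 (by linarith)
      nlinarith [sq_nonneg (1 - Q x), hD x]
    nlinarith [mul_le_mul_of_nonneg_left h4 (sq_nonneg C)]
  have hws : ∀ x, w x ^ 2 ≤ 0 + 1 * s x ^ 2 := fun x => by
    rw [sq (s x), hss]; nlinarith [hwQ x, hw0 x]
  have hsδ : ∀ x, |s x| ≤ 0 + √(δ⁻¹) * |√(Q x)| := fun x => by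
    rw [zero_add, abs_of_nonneg (Real.sqrt_nonneg (Q x)), ← Real.sqrt_mul (by positivity)]
    refine Real.abs_le_sqrt ?_
    rw [sq, hss]
    nlinarith [mul_le_mul_of_nonneg_left (hwδ x) (hQ0 x)]
  have hsd : u ∈ (mulOp s).domain := mem_mulDomain_of_le hs hsδ hu
  have hwd : ∀ z : L2, z ∈ (mulOp w).domain := mem_mulDomain_of_bounded hw.continuous (A := δ⁻¹)
    fun x => by rw [abs_of_nonneg (hw0 x)]; exact hwδ x
  have hwd' : u ∈ (mulOp (deriv w)).domain := by
    refine mem_mulDomain_of_le (m' := s) (contDiff_infty_iff_deriv.mp hw).2.continuous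
      (A := 2 * C) (B := 2 * C) (fun x => ?_) hsd
    refine abs_le_of_sq_le_sq ?_ (by positivity)
    have := hdwb x
    rw [← sq_abs (s x)] at this
    nlinarith [abs_nonneg (s x), mul_nonneg (sq_nonneg C) (abs_nonneg (s x)),
      mul_nonneg (sq_nonneg C) (sq_nonneg (|s x|)), sq_nonneg C]
  refine ⟨hsd, ?_⟩
  have hv' : HasWeakDeriv 1 (mulOp w ⟨u, hwd u⟩)
      ((mulOp (deriv w) ⟨u, hwd'⟩ + mulOp w ⟨u', hwd u'⟩ : L2) : ℝ → ℂ) := by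
    refine (hu'.smooth_mul hw).congr (coeFn_mulOp _).symm ?_
    filter_upwards [coeFn_mulOp hwd', coeFn_mulOp (hwd u'),
      Lp.coeFn_add (mulOp (deriv w) ⟨u, hwd'⟩) (mulOp w ⟨u', hwd u'⟩)] with x e1 e2 e3
    rw [e3, Pi.add_apply, e1, e2]
  have hv : mulOp w ⟨u, hwd u⟩ ∈ (mulOp fun x => √(Q x)).domain := by
    have h1 : u ∈ mulDomain fun x => √(Q x) * w x := by
      refine mem_mulDomain_of_le (m' := fun x => √(Q x)) (A := 0) (B := δ⁻¹)
        ((Real.continuous_sqrt.comp hQ.continuous).mul hw.continuous) (fun x => ?_) hu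
      change |√(Q x) * w x| ≤ 0 + δ⁻¹ * |√(Q x)|
      rw [zero_add, abs_mul, mul_comm, abs_of_nonneg (hw0 x)]
      exact mul_le_mul_of_nonneg_right (hwδ x) (abs_nonneg _)
    refine (memLp_congr_ae ?_).mp (mem_mulDomain.mp h1)
    filter_upwards [coeFn_mulOp (hwd u)] with x e
    rw [e]; push_cast; ring
  -- Testing with `w u` gives `⟨w' u, u'⟩ + ⟨w u', u'⟩ + ‖s u‖² = ⟨w u, f⟩`. The middle term has
  -- non-negative real part and is dropped; the first is the commutator.
  have key := form_identity hQ.continuous hQ0 hu huf' hv hv'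
  have e1 : inner ℂ (mulOp (fun x => √(Q x)) ⟨_, hv⟩) (mulOp (fun x => √(Q x)) ⟨u, hu⟩) =
      inner ℂ (mulOp s ⟨u, hsd⟩) (mulOp s ⟨u, hsd⟩) := by
    rw [inner_mulOp_mulOp, inner_mulOp_mulOp]
    refine integral_congr_ae ?_
    filter_upwards [coeFn_mulOp (hwd u)] with x e
    rw [e, hss, Real.mul_self_sqrt (hQ0 x), RCLike.inner_apply, RCLike.inner_apply, map_mul,
      Complex.conj_ofReal]
    push_cast
    ring
  rw [e1, inner_add_left] at key
  have key' := congrArg Complex.re key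
  rw [Complex.add_re, Complex.add_re, re_inner_self] at key'
  have p1 : 0 ≤ (inner ℂ (mulOp w ⟨u', hwd u'⟩) u').re := by
    have := re_inner_mulOp_self_nonneg hw0 (hwd u')
    rwa [inner_mulOp_right, ← inner_mulOp_left (hwd u')] at this
  have p2 : (inner ℂ (mulOp w ⟨u, hwd u⟩) f).re ≤ ‖mulOp w ⟨u, hwd u⟩‖ * ‖f‖ :=
    re_inner_le_norm (𝕜 := ℂ) _ _
  have p3 : -(inner ℂ (mulOp (deriv w) ⟨u, hwd'⟩) u').re ≤
      ‖mulOp (deriv w) ⟨u, hwd'⟩‖ * ‖u'‖ := by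
    refine (neg_le_abs _).trans ((Complex.abs_re_le_norm _).trans (norm_inner_le_norm _ _))
  have p4 := norm_mulOp_sq_le hws (hwd u) hsd
  have p5 := norm_mulOp_sq_le hdwb hwd' hsd
  have p6 : ‖u'‖ ^ 2 ≤ ‖u‖ * ‖f‖ := by
    have h1 := schrodinger_re_inner hQ.continuous hQ0 hu hu' huf'
    have h2 : (inner ℂ u f).re ≤ ‖u‖ * ‖f‖ := re_inner_le_norm (𝕜 := ℂ) _ _
    nlinarith [sq_nonneg ‖mulOp (fun x => √(Q x)) ⟨u, hu⟩‖]
  set X := ‖mulOp s ⟨u, hsd⟩‖ ^ 2 with hX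
  set α := ‖mulOp w ⟨u, hwd u⟩‖
  set β := ‖mulOp (deriv w) ⟨u, hwd'⟩‖
  -- Young's inequality here and in `p8` is weighted so that each term costs `X / 4`, leaving `X /
  -- 2` on the left.
  have p7 : α * ‖f‖ ≤ X / 4 + ‖f‖ ^ 2 := by nlinarith [sq_nonneg (α / 2 - ‖f‖)]
  have p8 : β * ‖u'‖ ≤ (‖u‖ ^ 2 + X) / 4 + 2 * (C ^ 2 + 1) * ‖u'‖ ^ 2 := by
    have hX0 : 0 ≤ X := sq_nonneg _
    have hk : 0 < C ^ 2 + 1 := by positivity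
    have h1 : β ^ 2 ≤ 2 * (C ^ 2 + 1) * (‖u‖ ^ 2 + X) := by nlinarith [sq_nonneg ‖u‖]
    have h2 : 0 ≤ (β - 4 * (C ^ 2 + 1) * ‖u'‖) ^ 2 := sq_nonneg _
    have h3 : 8 * (C ^ 2 + 1) * (β * ‖u'‖) ≤
        8 * (C ^ 2 + 1) * ((‖u‖ ^ 2 + X) / 4 + 2 * (C ^ 2 + 1) * ‖u'‖ ^ 2) := by nlinarith
    exact le_of_mul_le_mul_left h3 (by positivity)
  have p9 : ‖u'‖ ^ 2 ≤ (‖f‖ ^ 2 + ‖u‖ ^ 2) / 2 := by nlinarith [sq_nonneg (‖u‖ - ‖f‖)]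
  have p10 : 2 * (C ^ 2 + 1) * ‖u'‖ ^ 2 ≤ (C ^ 2 + 1) * (‖f‖ ^ 2 + ‖u‖ ^ 2) := by
    nlinarith [mul_le_mul_of_nonneg_left p9 (show 0 ≤ 2 * (C ^ 2 + 1) by positivity)]
  nlinarith [sq_nonneg ‖u‖, sq_nonneg ‖f‖, mul_nonneg (sq_nonneg C) (sq_nonneg ‖u‖),
    mul_nonneg (sq_nonneg C) (sq_nonneg ‖f‖)]

/-- Separation: if `|Q'| ≤ C (1 + Q)`, then the domain of `H_Q` is contained in that of `Q`. -/
theorem separation {Q : ℝ → ℝ} (hQ : ContDiff ℝ ∞ Q) (hQ0 : ∀ x, 0 ≤ Q x) {C : ℝ}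
    (hC : 0 ≤ C) (hQ' : ∀ x, |deriv Q x| ≤ C * (1 + Q x)) {u f : L2}
    (huf : (u, f) ∈ (schrodinger Q).graph) :
    ∃ h : u ∈ (mulOp Q).domain,
      ‖mulOp Q ⟨u, h⟩‖ ^ 2 ≤ (4 * C ^ 2 + 7) * (‖f‖ ^ 2 + ‖u‖ ^ 2) := by
  set N := (4 * C ^ 2 + 7) * (‖f‖ ^ 2 + ‖u‖ ^ 2) with hN
  have hN0 : 0 ≤ N := by positivity
  let δ : ℕ → ℝ := fun n => (n + 1 : ℝ)⁻¹
  have hδ : ∀ n, 0 < δ n := fun n => by positivity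
  have ht : Tendsto δ atTop (𝓝 0) := by
    simpa [δ, one_div] using tendsto_one_div_add_atTop_nhds_zero_nat (𝕜 := ℝ)
  choose hd hle using fun n => separation_regularized hQ hQ0 hC hQ' huf (hδ n)
  have hm : ∀ n, MemLp (fun x => ((Q x / √(1 + δ n * Q x) : ℝ) : ℂ) * u x) 2 volume :=
    fun n => mem_mulDomain.mp (hd n)
  have hbd : ∀ n, eLpNorm (fun x => ((Q x / √(1 + δ n * Q x) : ℝ) : ℂ) * u x) 2 volume ≤
      ENNReal.ofReal √N := by
    intro n
    rw [← ENNReal.ofReal_toReal (hm n).eLpNorm_ne_top]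
    refine ENNReal.ofReal_le_ofReal (Real.le_sqrt_of_sq_le ?_)
    rw [← Lp.norm_toLp _ (hm n)]
    exact hle n
  have hlim : ∀ x, Tendsto (fun n => ((Q x / √(1 + δ n * Q x) : ℝ) : ℂ) * u x) atTop
      (𝓝 ((Q x : ℂ) * u x)) := by
    intro x
    have h1 : Tendsto (fun n => Q x / √(1 + δ n * Q x)) atTop (𝓝 (Q x / √(1 + 0 * Q x))) := by
      refine tendsto_const_nhds.div ((Real.continuous_sqrt.tendsto _).comp
        (tendsto_const_nhds.add (ht.mul_const _))) ?_
      simp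
    rw [zero_mul, add_zero, Real.sqrt_one, div_one] at h1
    exact ((Complex.continuous_ofReal.tendsto _).comp h1).mul_const _
  have hmeas : AEStronglyMeasurable (fun x => (Q x : ℂ) * u x) volume :=
    (Complex.continuous_ofReal.comp hQ.continuous).aestronglyMeasurable.mul
      (Lp.aestronglyMeasurable u)
  -- The bound `N` does not involve `δ`, so Fatou's lemma gives both membership in `Dom(Q)` and the
  -- norm bound.
  have hfatou : eLpNorm (fun x => (Q x : ℂ) * u x) 2 volume ≤ ENNReal.ofReal √N := by
    refine (Lp.eLpNorm_lim_le_liminf_eLpNorm (fun n => (hm n).1) _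
      (Eventually.of_forall hlim)).trans ?_
    exact liminf_le_of_frequently_le' (Frequently.of_forall hbd)
  have hmem : MemLp (fun x => (Q x : ℂ) * u x) 2 volume :=
    ⟨hmeas, hfatou.trans_lt ENNReal.ofReal_lt_top⟩
  refine ⟨mem_mulDomain.mpr hmem, ?_⟩
  have : ‖mulOp Q ⟨u, mem_mulDomain.mpr hmem⟩‖ ≤ √N := by
    change ‖hmem.toLp _‖ ≤ √N
    rw [Lp.norm_toLp]
    exact ENNReal.toReal_le_of_le_ofReal (Real.sqrt_nonneg _) hfatou
  calc ‖mulOp Q ⟨u, mem_mulDomain.mpr hmem⟩‖ ^ 2 ≤ √N ^ 2 :=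
        pow_le_pow_left₀ (norm_nonneg _) this 2
    _ = N := Real.sq_sqrt hN0

end Separation

/-! ### Estimates for `T(μ)` -/

section Damped

lemma mem_quadOp_graph {a q : ℝ → ℝ} {μ : ℝ} {u f : L2} :
    (u, f) ∈ (quadOp a q μ).graph ↔ ∃ (ha : u ∈ (mulOp a).domain) (g : L2),
      (u, g) ∈ (schrodinger q).graph ∧
      f = g + (2 * μ : ℂ) • mulOp a ⟨u, ha⟩ + (μ ^ 2 : ℂ) • u := by
  constructor
  · intro h
    obtain ⟨⟨x, hx⟩, rfl, rfl⟩ := (LinearPMap.mem_graph_iff _).mp h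
    obtain ⟨⟨hx1, hx2⟩, -⟩ := id hx
    exact ⟨hx2, schrodinger q ⟨x, hx1⟩, LinearPMap.mem_graph _ ⟨x, hx1⟩, rfl⟩
  · rintro ⟨ha, g, hg, rfl⟩
    obtain ⟨⟨x, hx⟩, rfl, rfl⟩ := (LinearPMap.mem_graph_iff _).mp hg
    exact (LinearPMap.mem_graph_iff _).mpr ⟨⟨x, ⟨⟨hx, ha⟩, trivial⟩⟩, rfl, rfl⟩

variable {a q : ℝ → ℝ}

lemma Admissible.exists_q_le (h : Admissible a q) :
    ∃ M K : ℝ, 0 ≤ M ∧ 0 ≤ K ∧ ∀ x, q x ≤ M + K * a x := by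
  obtain ⟨x₀, hx₀, K, hK, hle⟩ := h.q_le_a
  obtain ⟨M, hM⟩ := (isCompact_Icc (a := -x₀) (b := x₀)).exists_bound_of_continuousOn
    h.smooth_q.continuous.continuousOn
  have hM0 : 0 ≤ M := (norm_nonneg _).trans (hM 0 ⟨by linarith, hx₀.le⟩)
  refine ⟨M, K, hM0, hK.le, fun x => ?_⟩
  rcases lt_or_ge x₀ |x| with hx | hx
  · linarith [hle x hx]
  · have h1 := (le_abs_self _).trans (hM x (abs_le.mp hx))
    nlinarith [mul_nonneg hK.le (h.nonneg_a x)]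

lemma ControlledDerivatives.exists_deriv_le {f : ℝ → ℝ} (h : ControlledDerivatives f)
    (hf : ∀ x, 0 ≤ f x) : ∃ C : ℝ, 0 ≤ C ∧ ∀ x, |deriv f x| ≤ C * (1 + f x) := by
  obtain ⟨C, hC, hb⟩ := h 1 le_rfl
  refine ⟨C, hC.le, fun x => ?_⟩
  have h1 := hb x
  rw [iteratedDeriv_one, pow_one] at h1
  refine h1.trans (mul_le_of_le_one_right (mul_nonneg hC.le (by linarith [hf x])) ?_)
  exact inv_le_one_of_one_le₀ (Real.one_le_sqrt.mpr (by nlinarith [sq_nonneg x]))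

/-- The potential `q + 2 μ a + μ²` of `T(μ)`. -/
def quadPotential (a q : ℝ → ℝ) (μ : ℝ) (x : ℝ) : ℝ := q x + 2 * μ * a x + μ ^ 2

lemma Admissible.quadPotential_nonneg (h : Admissible a q) {μ : ℝ} (hμ : 0 < μ) (x : ℝ) :
    0 ≤ quadPotential a q μ x := by
  have := h.nonneg_a x
  have := h.nonneg_q x
  unfold quadPotential
  positivity

lemma Admissible.contDiff_quadPotential (h : Admissible a q) (μ : ℝ) :
    ContDiff ℝ ∞ (quadPotential a q μ) :=
  (h.smooth_q.add (contDiff_const.mul h.smooth_a)).add contDiff_const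

/-- The constant is uniform in `μ`: the factor `2μ` multiplying the `1` in `1 + a` is absorbed by
the `μ²` in the potential through `2μ ≤ 1 + μ²`. -/
lemma Admissible.exists_deriv_quadPotential_le (h : Admissible a q) :
    ∃ C : ℝ, 0 ≤ C ∧ ∀ μ : ℝ, 0 < μ → ∀ x,
      |deriv (quadPotential a q μ) x| ≤ C * (1 + quadPotential a q μ x) := by
  obtain ⟨A, hA, ha⟩ := h.controlled_a.exists_deriv_le h.nonneg_a
  obtain ⟨B, hB, hq⟩ := h.controlled_q.exists_deriv_le h.nonneg_q
  refine ⟨2 * (A + B), by positivity, fun μ hμ x => ?_⟩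
  have da := (contDiff_infty_iff_deriv.mp h.smooth_a).1.differentiableAt.hasDerivAt (x := x)
  have dq := (contDiff_infty_iff_deriv.mp h.smooth_q).1.differentiableAt.hasDerivAt (x := x)
  have hd : deriv (quadPotential a q μ) x = deriv q x + 2 * μ * deriv a x :=
    ((dq.add (da.const_mul (2 * μ))).add_const (μ ^ 2)).deriv
  have h1 : |deriv (quadPotential a q μ) x| ≤ B * (1 + q x) + 2 * μ * (A * (1 + a x)) := by
    rw [hd]
    refine (abs_add_le _ _).trans (add_le_add (hq x) ?_)
    rw [abs_mul, abs_of_pos (by positivity : 0 < 2 * μ)]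
    exact mul_le_mul_of_nonneg_left (ha x) (by positivity)
  refine h1.trans ?_
  have ha0 := h.nonneg_a x
  have hq0 := h.nonneg_q x
  have h2 : 1 + q x ≤ 2 * (1 + quadPotential a q μ x) := by
    unfold quadPotential
    nlinarith [mul_nonneg hμ.le ha0, sq_nonneg μ]
  have h3 : 2 * μ * (1 + a x) ≤ 2 * (1 + quadPotential a q μ x) := by
    unfold quadPotential
    nlinarith [mul_nonneg hμ.le ha0, sq_nonneg (μ - 1)]
  nlinarith [mul_le_mul_of_nonneg_left h2 hB, mul_le_mul_of_nonneg_left h3 hA]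

lemma Admissible.mulDomain_a_le_q (h : Admissible a q) {u : L2} (ha : u ∈ (mulOp a).domain) :
    u ∈ (mulOp q).domain := by
  obtain ⟨M, K, -, -, hle⟩ := h.exists_q_le
  refine mem_mulDomain_of_le h.smooth_q.continuous (A := M) (B := K) (fun x => ?_) ha
  rw [abs_of_nonneg (h.nonneg_q x), abs_of_nonneg (h.nonneg_a x)]
  exact hle x

lemma sqrt_le_one_add {t : ℝ} (ht : 0 ≤ t) : √t ≤ 1 + t :=
  Real.sqrt_le_iff.mpr ⟨by linarith, by nlinarith⟩

lemma mem_mulDomain_sqrt {m : ℝ → ℝ} (hm : Continuous m) (h0 : ∀ x, 0 ≤ m x) {u : L2}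
    (hu : u ∈ (mulOp m).domain) : u ∈ (mulOp fun x => √(m x)).domain := by
  refine mem_mulDomain_of_le (Real.continuous_sqrt.comp hm) (A := 1) (B := 1) (fun x => ?_) hu
  change |√(m x)| ≤ _
  rw [abs_of_nonneg (Real.sqrt_nonneg _), abs_of_nonneg (h0 x), one_mul]
  exact sqrt_le_one_add (h0 x)

lemma Admissible.mulDomain_a_le_quadPotential (h : Admissible a q) {μ : ℝ} (hμ : 0 < μ) {u : L2}
    (ha : u ∈ (mulOp a).domain) : u ∈ (mulOp (quadPotential a q μ)).domain := by
  obtain ⟨M, K, -, -, hle⟩ := h.exists_q_le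
  refine mem_mulDomain_of_le (h.contDiff_quadPotential μ).continuous (A := M + μ ^ 2)
    (B := K + 2 * μ) (fun x => ?_) ha
  rw [abs_of_nonneg (h.quadPotential_nonneg hμ x), abs_of_nonneg (h.nonneg_a x), quadPotential]
  linarith [hle x]

/-- `T(μ)` is the Schrödinger operator with potential `q + 2 μ a + μ²`. -/
theorem Admissible.quadOp_eq (h : Admissible a q) {μ : ℝ} (hμ : 0 < μ) :
    quadOp a q μ = schrodinger (quadPotential a q μ) := by
  have hs := h.contDiff_quadPotential μ
  have h0 := h.quadPotential_nonneg hμ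
  have hae : ∀ {u f g : L2} (ha : u ∈ (mulOp a).domain),
      f = g + (2 * μ : ℂ) • mulOp a ⟨u, ha⟩ + (μ ^ 2 : ℂ) • u →
      (fun x => (quadPotential a q μ x : ℂ) * u x - f x) =ᵐ[volume]
        fun x => (q x : ℂ) * u x - g x := by
    rintro u f g ha rfl
    filter_upwards [Lp.coeFn_add (g + (2 * μ : ℂ) • mulOp a ⟨u, ha⟩) ((μ ^ 2 : ℂ) • u),
      Lp.coeFn_add g ((2 * μ : ℂ) • mulOp a ⟨u, ha⟩), Lp.coeFn_smul (μ ^ 2 : ℂ) u,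
      Lp.coeFn_smul (2 * μ : ℂ) (mulOp a ⟨u, ha⟩), coeFn_mulOp ha] with x e1 e2 e3 e4 e5
    rw [e1, Pi.add_apply, e2, Pi.add_apply, e3, e4, Pi.smul_apply, Pi.smul_apply, e5,
      quadPotential]
    simp only [smul_eq_mul]
    push_cast
    ring
  apply LinearPMap.eq_of_eq_graph
  ext ⟨u, f⟩
  rw [mem_quadOp_graph]
  constructor
  · rintro ⟨ha, g, hg, e⟩
    obtain ⟨-, u', hu', hug⟩ := mem_schrodinger_graph.mp hg
    exact mem_schrodinger_graph.mpr ⟨mem_mulDomain_sqrt hs.continuous h0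
      (h.mulDomain_a_le_quadPotential hμ ha), u', hu',
      hug.congr (EventuallyEq.refl _ _) (hae ha e).symm⟩
  · intro hf
    obtain ⟨C, hC, hd⟩ := h.exists_deriv_quadPotential_le
    -- This inclusion is the substantial one: membership in `Dom(a)` comes from `Q u ∈ L²` and `2μa
    -- ≤ Q`.
    obtain ⟨hQ, -⟩ := separation hs h0 hC (hd μ hμ) hf
    obtain ⟨-, u', hu', huf⟩ := mem_schrodinger_graph.mp hf
    have ha : u ∈ (mulOp a).domain := by
      refine mem_mulDomain_of_le h.smooth_a.continuous (A := 0) (B := (2 * μ)⁻¹) (fun x => ?_) hQ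
      rw [abs_of_nonneg (h.nonneg_a x), abs_of_nonneg (h0 x), zero_add, ← div_eq_inv_mul,
        le_div_iff₀ (by positivity), quadPotential]
      nlinarith [h.nonneg_q x, sq_nonneg μ]
    have e : f = (f - (2 * μ : ℂ) • mulOp a ⟨u, ha⟩ - (μ ^ 2 : ℂ) • u) +
      (2 * μ : ℂ) • mulOp a ⟨u, ha⟩ + (μ ^ 2 : ℂ) • u := by abel
    exact ⟨ha, _, mem_schrodinger_graph.mpr ⟨mem_mulDomain_sqrt h.smooth_q.continuous h.nonneg_q
      (h.mulDomain_a_le_q ha), u', hu', huf.congr (EventuallyEq.refl _ _) (hae ha e)⟩, e⟩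

lemma Admissible.isMaxNonneg_quadOp (h : Admissible a q) {μ : ℝ} (hμ : 0 < μ) :
    IsMaxNonneg (quadOp a q μ) := by
  rw [h.quadOp_eq hμ]
  exact isMaxNonneg_schrodinger (h.contDiff_quadPotential μ).continuous
    (h.quadPotential_nonneg hμ)

lemma Admissible.isMaxNonneg_schrodinger (h : Admissible a q) : IsMaxNonneg (schrodinger q) :=
  DampedWave.isMaxNonneg_schrodinger h.smooth_q.continuous h.nonneg_q

lemma Admissible.form_le (h : Admissible a q) {μ : ℝ} (hμ : 0 < μ) {u f : L2}
    (hu : (u, f) ∈ (quadOp a q μ).graph) : ∃ g, (u, g) ∈ (schrodinger q).graph ∧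
      (inner ℂ u g).re + μ ^ 2 * ‖u‖ ^ 2 ≤ (inner ℂ u f).re := by
  obtain ⟨ha, g, hg, rfl⟩ := mem_quadOp_graph.mp hu
  refine ⟨g, hg, ?_⟩
  have h1 := re_inner_mulOp_self_nonneg h.nonneg_a ha
  have e1 : ((2 * μ : ℂ)) = ((2 * μ : ℝ) : ℂ) := by push_cast; rfl
  have e2 : ((μ ^ 2 : ℂ)) = ((μ ^ 2 : ℝ) : ℂ) := by push_cast; rfl
  rw [inner_add_right, inner_add_right, inner_smul_right, inner_smul_right, e1, e2,
    Complex.add_re, Complex.add_re, Complex.re_ofReal_mul, Complex.re_ofReal_mul, re_inner_self]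
  have : 0 ≤ 2 * μ * (inner ℂ u (mulOp a ⟨u, ha⟩)).re := by positivity
  linarith

lemma Admissible.coercive (h : Admissible a q) {μ : ℝ} (hμ : 0 < μ) (u f : L2)
    (hu : (u, f) ∈ (quadOp a q μ).graph) : μ ^ 2 * ‖u‖ ^ 2 ≤ (inner ℂ u f).re := by
  obtain ⟨g, hg, hle⟩ := h.form_le hμ hu
  linarith [h.isMaxNonneg_schrodinger.nonneg _ _ hg]

lemma Admissible.norm_le (h : Admissible a q) {μ : ℝ} (hμ : 0 < μ) {u f : L2}
    (hu : (u, f) ∈ (quadOp a q μ).graph) : μ ^ 2 * ‖u‖ ≤ ‖f‖ := by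
  have h1 := h.coercive hμ u f hu
  have h2 : (inner ℂ u f).re ≤ ‖u‖ * ‖f‖ := re_inner_le_norm (𝕜 := ℂ) _ _
  rcases (norm_nonneg u).eq_or_lt with h0 | h0
  · rw [← h0]; simp
  · nlinarith

/-- On `Dom(a)` the bound `q ≤ M + K a` puts `q u` in `L²`, so there `u''` and `-u'' + q u` are in
`L²` together. -/
lemma Admissible.quadOp_domain (h : Admissible a q) (μ : ℝ) :
    (quadOp a q μ).domain = sobolev 2 ⊓ (mulOp a).domain := by
  ext u
  rw [LinearPMap.mem_domain_iff, Submodule.mem_inf, mem_sobolev_two]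
  simp only [mem_quadOp_graph]
  constructor
  · rintro ⟨f, ha, g, hg, -⟩
    obtain ⟨-, u', hu', hug⟩ := mem_schrodinger_graph.mp hg
    have hq := h.mulDomain_a_le_q ha
    refine ⟨⟨⟨u', hu'⟩, mulOp q ⟨u, hq⟩ - g, ?_⟩, ha⟩
    refine (hu'.two_iff.mpr hug).congr (EventuallyEq.refl _ _) ?_
    filter_upwards [Lp.coeFn_sub (mulOp q ⟨u, hq⟩) g, coeFn_mulOp hq] with x e1 e2
    rw [e1, Pi.sub_apply, e2]
  · rintro ⟨⟨⟨u', hu'⟩, w, hw⟩, ha⟩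
    have hq := h.mulDomain_a_le_q ha
    refine ⟨_, ha, mulOp q ⟨u, hq⟩ - w, mem_schrodinger_graph.mpr
      ⟨mem_mulDomain_sqrt h.smooth_q.continuous h.nonneg_q hq, u', hu', ?_⟩, rfl⟩
    refine (hu'.two_iff.mp hw).congr (EventuallyEq.refl _ _) ?_
    filter_upwards [Lp.coeFn_sub (mulOp q ⟨u, hq⟩) w, coeFn_mulOp hq] with x e1 e2
    rw [e1, Pi.sub_apply, e2]
    ring

/-- The separation estimate for `T(μ)`. -/
lemma Admissible.exists_separation (h : Admissible a q) : ∃ K : ℝ, 0 ≤ K ∧ ∀ μ : ℝ, 0 < μ →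
    ∀ u f : L2, (u, f) ∈ (quadOp a q μ).graph →
      ∃ hQ : u ∈ (mulOp (quadPotential a q μ)).domain,
        ‖mulOp (quadPotential a q μ) ⟨u, hQ⟩‖ ^ 2 ≤ K * (‖f‖ ^ 2 + ‖u‖ ^ 2) := by
  obtain ⟨C, hC, hd⟩ := h.exists_deriv_quadPotential_le
  refine ⟨4 * C ^ 2 + 7, by positivity, fun μ hμ u f hu => ?_⟩
  rw [h.quadOp_eq hμ] at hu
  exact separation (h.contDiff_quadPotential μ) (h.quadPotential_nonneg hμ) hC (hd μ hμ) hu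

lemma Admissible.norm_mulOp_a_le (h : Admissible a q) {μ : ℝ} (hμ : 0 < μ) {u : L2}
    (ha : u ∈ (mulOp a).domain) (hQ : u ∈ (mulOp (quadPotential a q μ)).domain) :
    2 * μ * ‖mulOp a ⟨u, ha⟩‖ ≤ ‖mulOp (quadPotential a q μ) ⟨u, hQ⟩‖ := by
  have h1 := norm_mulOp_sq_le (A := 0) (B := ((2 * μ) ^ 2)⁻¹) (fun x => ?_) ha hQ
  · refine abs_le_of_sq_le_sq' ?_ (norm_nonneg _) |>.2
    rw [zero_mul, zero_add, ← div_eq_inv_mul, le_div_iff₀ (by positivity)] at h1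
    linarith
  · rw [zero_add, ← div_eq_inv_mul, le_div_iff₀ (by positivity), ← mul_pow]
    have ha0 := h.nonneg_a x
    refine pow_le_pow_left₀ (by positivity) ?_ 2
    rw [quadPotential]
    nlinarith [h.nonneg_q x, sq_nonneg μ]

lemma Admissible.norm_mulOp_q_le (h : Admissible a q) {μ : ℝ} (hμ : 0 < μ) {u : L2}
    (hq : u ∈ (mulOp q).domain) (hQ : u ∈ (mulOp (quadPotential a q μ)).domain) :
    ‖mulOp q ⟨u, hq⟩‖ ≤ ‖mulOp (quadPotential a q μ) ⟨u, hQ⟩‖ := by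
  have h1 := norm_mulOp_sq_le (A := 0) (B := 1) (fun x => ?_) hq hQ
  · exact abs_le_of_sq_le_sq' (by linarith) (norm_nonneg _) |>.2
  · rw [zero_add, one_mul]
    refine pow_le_pow_left₀ (h.nonneg_q x) ?_ 2
    rw [quadPotential]
    have ha0 := h.nonneg_a x
    have : 0 ≤ 2 * μ * a x := by positivity
    nlinarith [sq_nonneg μ]

lemma Admissible.exists_regularity_estimate (h : Admissible a q) :
    ∃ C : ℝ, 0 < C ∧ ∀ᶠ μ : ℝ in atTop, ∀ u : (quadOp a q μ).domain,
      ∃ (h₂ : (u : L2) ∈ (weakDeriv 2).domain) (hq : (u : L2) ∈ (mulOp q).domain)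
        (ha : (u : L2) ∈ (mulOp a).domain),
        ‖weakDeriv 2 ⟨u, h₂⟩‖ ^ 2 + ‖mulOp q ⟨u, hq⟩‖ ^ 2 + μ ^ 2 * ‖mulOp a ⟨u, ha⟩‖ ^ 2 ≤
          C * (‖quadOp a q μ u‖ ^ 2 + μ ^ 2 * ‖(u : L2)‖ ^ 2) := by
  obtain ⟨K, hK, hsep⟩ := h.exists_separation
  -- With `X = ‖Qu‖` and `u'' = Qu - f`, the three terms are at most `2X² + 2‖f‖²`, `X²` and `X²`,
  -- and `X² ≤ K(‖f‖² + ‖u‖²)`.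
  refine ⟨4 * K + 2, by positivity, ?_⟩
  filter_upwards [eventually_ge_atTop 1] with μ hμ u
  have hμ0 : 0 < μ := by linarith
  have hu := (quadOp a q μ).mem_graph u
  set f := quadOp a q μ u
  obtain ⟨hQ, hle⟩ := hsep μ hμ0 _ _ hu
  obtain ⟨ha, -, -, -⟩ := mem_quadOp_graph.mp hu
  have hq := h.mulDomain_a_le_q ha
  obtain ⟨-, u', hu', huf⟩ := mem_schrodinger_graph.mp
    ((congrArg LinearPMap.graph (h.quadOp_eq hμ0)).le hu)
  have hg : ((u : L2), mulOp (quadPotential a q μ) ⟨u, hQ⟩ - f) ∈ (weakDeriv 2).graph := by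
    rw [mem_weakDeriv_graph]
    refine (hu'.two_iff.mpr huf).congr (EventuallyEq.refl _ _) ?_
    filter_upwards [Lp.coeFn_sub (mulOp (quadPotential a q μ) ⟨u, hQ⟩) f, coeFn_mulOp hQ]
      with x e1 e2
    rw [e1, Pi.sub_apply, e2]
  have h₂ := LinearPMap.mem_domain_of_mem_graph hg
  refine ⟨h₂, hq, ha, ?_⟩
  rw [← (LinearPMap.image_iff h₂).mpr hg]
  have n1 := h.norm_mulOp_a_le hμ0 ha hQ
  have n2 := h.norm_mulOp_q_le hμ0 hq hQ
  have n3 := norm_sub_le (mulOp (quadPotential a q μ) ⟨u, hQ⟩) f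
  set X := ‖mulOp (quadPotential a q μ) ⟨u, hQ⟩‖
  have hX : 0 ≤ X := norm_nonneg _
  have m1 : μ ^ 2 * ‖mulOp a ⟨u, ha⟩‖ ^ 2 ≤ X ^ 2 := by
    rw [← mul_pow]
    refine pow_le_pow_left₀ (by positivity) ?_ 2
    nlinarith [mul_nonneg hμ0.le (norm_nonneg (mulOp a ⟨u, ha⟩))]
  have m2 : ‖mulOp q ⟨u, hq⟩‖ ^ 2 ≤ X ^ 2 := pow_le_pow_left₀ (norm_nonneg _) n2 2
  have m3 : ‖mulOp (quadPotential a q μ) ⟨u, hQ⟩ - f‖ ^ 2 ≤ 2 * X ^ 2 + 2 * ‖f‖ ^ 2 := by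
    have := pow_le_pow_left₀ (norm_nonneg _) n3 2
    nlinarith [sq_nonneg (X - ‖f‖)]
  have m4 : ‖(u : L2)‖ ^ 2 ≤ μ ^ 2 * ‖(u : L2)‖ ^ 2 :=
    le_mul_of_one_le_left (sq_nonneg _) (one_le_pow₀ hμ)
  have m5 := mul_le_mul_of_nonneg_left m4 hK
  nlinarith [sq_nonneg ‖f‖, sq_nonneg ‖(u : L2)‖]

lemma Admissible.exists_norm_schrodinger_le (h : Admissible a q) :
    ∃ C : ℝ, 0 < C ∧ ∀ μ : ℝ, 1 ≤ μ → ∀ u f : L2, (u, f) ∈ (quadOp a q μ).graph →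
      ∃ g, (u, g) ∈ (schrodinger q).graph ∧ ‖g‖ ≤ C * ‖f‖ := by
  obtain ⟨K, hK, hsep⟩ := h.exists_separation
  -- In `H_q u = f - 2μ a u - μ² u` the first and last terms each contribute `‖f‖`, and the middle
  -- one is at most `‖Qu‖ ≤ √(2K) ‖f‖`, using `‖u‖ ≤ ‖f‖` for `μ ≥ 1`.
  refine ⟨2 + √(2 * K), by positivity, fun μ hμ u f hu => ?_⟩
  have hμ0 : 0 < μ := by linarith
  obtain ⟨hQ, hle⟩ := hsep μ hμ0 _ _ hu
  have n1 := h.norm_le hμ0 hu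
  obtain ⟨ha, g, hg, e⟩ := mem_quadOp_graph.mp hu
  refine ⟨g, hg, ?_⟩
  have n2 := h.norm_mulOp_a_le hμ0 ha hQ
  have hu1 : ‖u‖ ≤ ‖f‖ :=
    (le_mul_of_one_le_left (norm_nonneg _) (one_le_pow₀ hμ)).trans n1
  have n3 : ‖mulOp (quadPotential a q μ) ⟨u, hQ⟩‖ ≤ √(2 * K) * ‖f‖ := by
    refine abs_le_of_sq_le_sq' ?_ (by positivity) |>.2
    rw [mul_pow, Real.sq_sqrt (by positivity)]
    have := pow_le_pow_left₀ (norm_nonneg _) hu1 2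
    nlinarith
  have e' : g = f - (2 * μ : ℂ) • mulOp a ⟨u, ha⟩ - (μ ^ 2 : ℂ) • u := by rw [e]; abel
  have n4 : ‖(2 * μ : ℂ) • mulOp a ⟨u, ha⟩‖ = 2 * μ * ‖mulOp a ⟨u, ha⟩‖ := by
    rw [norm_smul]; simp [abs_of_pos hμ0]
  have n5 : ‖(μ ^ 2 : ℂ) • u‖ = μ ^ 2 * ‖u‖ := by
    rw [norm_smul]; simp
  have n6 := norm_sub_le (f - (2 * μ : ℂ) • mulOp a ⟨u, ha⟩) ((μ ^ 2 : ℂ) • u)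
  have n7 := norm_sub_le f ((2 * μ : ℂ) • mulOp a ⟨u, ha⟩)
  rw [← e', n5] at n6
  rw [n4] at n7
  linarith

/-- The chain is `‖H_q^{1/2}u‖² = ⟨u, H_q u⟩ ≤ Re⟨u, f⟩ ≤ ‖u‖ ‖f‖ ≤ μ⁻² ‖f‖²`. -/
lemma Admissible.exists_norm_sqrt_le (h : Admissible a q) {μ : ℝ} (hμ : 0 < μ) {u f : L2}
    (hu : (u, f) ∈ (quadOp a q μ).graph) :
    ∃ g, (u, g) ∈ (posSqrt (schrodinger q)).graph ∧ ‖g‖ ≤ μ⁻¹ * ‖f‖ := by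
  obtain ⟨g, hg, hle⟩ := h.form_le hμ hu
  obtain ⟨z, hz, -, hzn⟩ := h.isMaxNonneg_schrodinger.isPosSqrt_posSqrt.exists_of_mem_graph hg
  refine ⟨z, hz, abs_le_of_sq_le_sq' ?_ (by positivity) |>.2⟩
  have n1 := h.norm_le hμ hu
  have n2 : (inner ℂ u f).re ≤ ‖u‖ * ‖f‖ := re_inner_le_norm (𝕜 := ℂ) _ _
  rw [mul_pow, inv_pow, ← div_eq_inv_mul, le_div_iff₀ (by positivity), hzn]
  have n3 : (inner ℂ u g).re ≤ ‖u‖ * ‖f‖ := by nlinarith [mul_nonneg (sq_nonneg μ) (sq_nonneg ‖u‖)]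
  calc (inner ℂ u g).re * μ ^ 2 ≤ ‖u‖ * ‖f‖ * μ ^ 2 :=
        mul_le_mul_of_nonneg_right n3 (sq_nonneg μ)
    _ = μ ^ 2 * ‖u‖ * ‖f‖ := by ring
    _ ≤ ‖f‖ * ‖f‖ := mul_le_mul_of_nonneg_right n1 (norm_nonneg f)
    _ = ‖f‖ ^ 2 := (sq _).symm

lemma Admissible.quadOp_surjective (h : Admissible a q) {μ : ℝ} (hμ : 0 < μ) (f : L2) :
    ∃ u, (u, f) ∈ (quadOp a q μ).graph :=
  (h.isMaxNonneg_quadOp hμ).surjective_of_coercive (by positivity) (h.coercive hμ) f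

lemma Admissible.ker_quadOp (h : Admissible a q) {μ : ℝ} (hμ : 0 < μ) :
    LinearMap.ker (quadOp a q μ).toFun = ⊥ := by
  refine ker_eq_bot_of_graph fun u hu => ?_
  have := h.norm_le hμ hu
  rw [norm_zero] at this
  have h2 : 0 < μ ^ 2 := by positivity
  exact norm_le_zero_iff.mp (by nlinarith [norm_nonneg u])

lemma Admissible.sqrt_quadOp_surjective (h : Admissible a q) {μ : ℝ} (hμ : 0 < μ) (f : L2) :
    ∃ u, (u, f) ∈ (posSqrt (quadOp a q μ)).graph := by
  obtain ⟨u, hu⟩ := h.quadOp_surjective hμ f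
  obtain ⟨z, -, hz, -⟩ := (h.isMaxNonneg_quadOp hμ).isPosSqrt_posSqrt.exists_of_mem_graph hu
  exact ⟨z, hz⟩

lemma Admissible.ker_sqrt_quadOp (h : Admissible a q) {μ : ℝ} (hμ : 0 < μ) :
    LinearMap.ker (posSqrt (quadOp a q μ)).toFun = ⊥ := by
  refine ker_eq_bot_of_graph fun u hu => ?_
  have hT : (u, (0 : L2)) ∈ (quadOp a q μ).graph := by
    rw [← (h.isMaxNonneg_quadOp hμ).isPosSqrt_posSqrt.sq, mem_graph_opComp]
    exact ⟨0, hu, zero_mem _⟩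
  have := h.norm_le hμ hT
  rw [norm_zero] at this
  have h2 : 0 < μ ^ 2 := by positivity
  exact norm_le_zero_iff.mp (by nlinarith [norm_nonneg u])

end Damped

end DampedWave

/-! ### The main theorem -/

open DampedWave

theorem mainTheorem7 (a q : ℝ → ℝ) (h : Admissible a q) :
    -- `H_q^{1/2}` is well defined
    IsPosSqrt (schrodinger q)
      (posSqrt (schrodinger q)) ∧
    -- for each `μ > 0`: the domain of `T(μ)`; `T(μ)⁻¹`, `T(μ)^{1/2}` and
    -- `T(μ)^{-1/2} = (T(μ)^{1/2})⁻¹` are well defined, and so are the products below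
    (∀ μ : ℝ, 0 < μ →
      (quadOp a q μ).domain =
        sobolev 2 ⊓ (mulOp a).domain ∧
      LinearMap.ker (quadOp a q μ).toFun = ⊥ ∧
      (quadOp a q μ).inverse.domain = ⊤ ∧
      IsPosSqrt (quadOp a q μ)
        (posSqrt (quadOp a q μ)) ∧
      LinearMap.ker (posSqrt (quadOp a q μ)).toFun = ⊥ ∧
      (posSqrt (quadOp a q μ)).inverse.domain = ⊤ ∧
      (opComp (schrodinger q)
        (quadOp a q μ).inverse).domain = ⊤ ∧
      Dense ((opComp (quadOp a q μ).inverse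
        (schrodinger q)).domain : Set L2) ∧
      (opComp (posSqrt (schrodinger q))
        (quadOp a q μ).inverse).domain = ⊤ ∧
      Dense ((opComp (quadOp a q μ).inverse
        (posSqrt (schrodinger q))).domain : Set L2) ∧
      (opComp (posSqrt (schrodinger q))
        (posSqrt (quadOp a q μ)).inverse).domain = ⊤ ∧
      Dense ((opComp (posSqrt (quadOp a q μ)).inverse
        (posSqrt (schrodinger q))).domain : Set L2)) ∧
    -- `‖u''‖² + ‖q u‖² + μ² ‖a u‖² ≲ ‖T(μ) u‖² + μ² ‖u‖²` as `μ → +∞`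
    (∃ C : ℝ, 0 < C ∧ ∀ᶠ μ : ℝ in Filter.atTop, ∀ u : (quadOp a q μ).domain,
      ∃ (h₂ : (u : L2) ∈ (weakDeriv 2).domain)
        (hq : (u : L2) ∈ (mulOp q).domain)
        (ha : (u : L2) ∈ (mulOp a).domain),
        ‖weakDeriv 2 ⟨u, h₂⟩‖ ^ 2 + ‖mulOp q ⟨u, hq⟩‖ ^ 2 +
            μ ^ 2 * ‖mulOp a ⟨u, ha⟩‖ ^ 2 ≤
          C * (‖quadOp a q μ u‖ ^ 2 + μ ^ 2 * ‖(u : L2)‖ ^ 2)) ∧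
    -- `‖T(μ)⁻¹‖ ≤ μ⁻²` for `μ > 0`
    (∀ μ : ℝ, 0 < μ →
      opNorm (quadOp a q μ).inverse ≤ ENNReal.ofReal ((μ ^ 2)⁻¹)) ∧
    -- `‖H_q T(μ)⁻¹‖ + ‖T(μ)⁻¹ H_q‖ ≲ 1` as `μ → +∞`
    (∃ C : ℝ, 0 < C ∧ ∀ᶠ μ : ℝ in Filter.atTop,
      opNorm (opComp (schrodinger q)
          (quadOp a q μ).inverse) +
        opNorm (opComp (quadOp a q μ).inverse
          (schrodinger q)) ≤ ENNReal.ofReal C) ∧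
    -- `‖H_q^{1/2} T(μ)⁻¹‖ + ‖T(μ)⁻¹ H_q^{1/2}‖ ≲ μ⁻¹` as `μ → +∞`
    (∃ C : ℝ, 0 < C ∧ ∀ᶠ μ : ℝ in Filter.atTop,
      opNorm (opComp (posSqrt (schrodinger q))
          (quadOp a q μ).inverse) +
        opNorm (opComp (quadOp a q μ).inverse
          (posSqrt (schrodinger q))) ≤ ENNReal.ofReal (C * μ⁻¹)) ∧
    -- `‖H_q^{1/2} T(μ)^{-1/2}‖ + ‖T(μ)^{-1/2} H_q^{1/2}‖ ≲ 1` for `μ > 0`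
    (∃ C : ℝ, 0 < C ∧ ∀ μ : ℝ, 0 < μ →
      opNorm (opComp (posSqrt (schrodinger q))
          (posSqrt (quadOp a q μ)).inverse) +
        opNorm (opComp
          (posSqrt (quadOp a q μ)).inverse
          (posSqrt (schrodinger q))) ≤ ENNReal.ofReal C) := by
  have hH := h.isMaxNonneg_schrodinger
  have hHs := hH.isPosSqrt_posSqrt
  have symD := isSymm_of_isSelfAdjoint hHs.selfAdjoint
  have prodSqrt : ∀ μ : ℝ, 0 < μ → _ := fun μ hμ =>
    product_inverse_bounds (G := posSqrt (schrodinger q)) (h.ker_quadOp hμ)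
      (h.quadOp_surjective hμ) (h.isMaxNonneg_quadOp hμ).symm symD (inv_nonneg.mpr hμ.le)
      fun _ _ hu => h.exists_norm_sqrt_le hμ hu
  -- Form comparison of `H_q` with `T(μ)` gives `‖H_q^{1/2}u‖ ≤ ‖T(μ)^{1/2}u‖`, so the constant is
  -- `1` for every `μ > 0`.
  have prodSqrtSqrt : ∀ μ : ℝ, 0 < μ → _ := fun μ hμ =>
    product_inverse_bounds (G := posSqrt (schrodinger q)) (h.ker_sqrt_quadOp hμ)
      (h.sqrt_quadOp_surjective hμ)
      (isSymm_of_isSelfAdjoint (h.isMaxNonneg_quadOp hμ).isPosSqrt_posSqrt.selfAdjoint) symD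
      zero_le_one fun u f hu => by
        rw [one_mul]
        refine hHs.le_of_form_le (h.isMaxNonneg_quadOp hμ).isPosSqrt_posSqrt
          (c := μ ^ 2) (by positivity) (h.coercive hμ) (h.quadOp_surjective hμ)
          (fun x y hx => ?_) hu
        obtain ⟨g, hg, hle⟩ := h.form_le hμ hx
        exact ⟨g, hg, le_trans (le_add_of_nonneg_right (by positivity)) hle⟩
  -- The norm bound on `H_q T(μ)⁻¹` is available only for `μ ≥ 1`, so the domains for all `μ > 0`
  -- are found directly.
  have domH : ∀ μ : ℝ, 0 < μ → (opComp (schrodinger q) (quadOp a q μ).inverse).domain = ⊤ ∧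
      (opComp (quadOp a q μ).inverse (schrodinger q)).domain = (schrodinger q).domain := by
    intro μ hμ
    constructor
    · rw [eq_top_iff]
      intro f _
      obtain ⟨u, hu⟩ := h.quadOp_surjective hμ f
      obtain ⟨g, hg, -⟩ := h.form_le hμ hu
      exact LinearPMap.mem_domain_of_mem_graph
        (mem_graph_opComp.mpr ⟨u, (mem_graph_inverse (h.ker_quadOp hμ)).mpr hu, hg⟩)
    · ext u
      simp only [LinearPMap.mem_domain_iff, mem_graph_opComp]
      refine ⟨fun ⟨_, y, hy, _⟩ => ⟨y, hy⟩, fun ⟨y, hy⟩ => ?_⟩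
      obtain ⟨x, hx⟩ := h.quadOp_surjective hμ y
      exact ⟨x, y, hy, (mem_graph_inverse (h.ker_quadOp hμ)).mpr hx⟩
  refine ⟨hHs, fun μ hμ => ?_, h.exists_regularity_estimate, fun μ hμ => ?_, ?_, ?_, ?_⟩
  · refine ⟨h.quadOp_domain μ, h.ker_quadOp hμ, inverse_domain_eq_top (h.quadOp_surjective hμ),
      (h.isMaxNonneg_quadOp hμ).isPosSqrt_posSqrt, h.ker_sqrt_quadOp hμ,
      inverse_domain_eq_top (h.sqrt_quadOp_surjective hμ), (domH μ hμ).1, ?_,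
      (prodSqrt μ hμ).1, ?_, (prodSqrtSqrt μ hμ).1, ?_⟩
    · rw [(domH μ hμ).2]; exact hH.dense_domain
    · rw [(prodSqrt μ hμ).2.2.1]; exact hHs.selfAdjoint.dense_domain
    · rw [(prodSqrtSqrt μ hμ).2.2.1]; exact hHs.selfAdjoint.dense_domain
  · refine opNorm_le (by positivity) fun f u hu => ?_
    rw [mem_graph_inverse (h.ker_quadOp hμ)] at hu
    rw [← div_eq_inv_mul, le_div_iff₀ (by positivity), mul_comm]
    exact h.norm_le hμ hu
  · obtain ⟨C, hC, hb⟩ := h.exists_norm_schrodinger_le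
    refine ⟨C + C, by positivity, ?_⟩
    filter_upwards [Filter.eventually_ge_atTop 1] with μ hμ
    have hμ0 : 0 < μ := by linarith
    obtain ⟨-, h1, -, h2⟩ := product_inverse_bounds (h.ker_quadOp hμ0) (h.quadOp_surjective hμ0)
      (h.isMaxNonneg_quadOp hμ0).symm hH.symm hC.le (hb μ hμ)
    rw [ENNReal.ofReal_add hC.le hC.le]
    exact add_le_add h1 h2
  · refine ⟨2, two_pos, ?_⟩
    filter_upwards [Filter.eventually_gt_atTop 0] with μ hμ
    obtain ⟨-, h1, -, h2⟩ := prodSqrt μ hμ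
    have hi : 0 ≤ μ⁻¹ := inv_nonneg.mpr hμ.le
    rw [two_mul, ENNReal.ofReal_add hi hi]
    exact add_le_add h1 h2
  · refine ⟨1 + 1, by norm_num, fun μ hμ => ?_⟩
    obtain ⟨-, h1, -, h2⟩ := prodSqrtSqrt μ hμ
    rw [ENNReal.ofReal_add zero_le_one zero_le_one]
    exact add_le_add h1 h2
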